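/- Let $(\mathcal X,\mu)$ be a measure space, $M\ge 2$ and $n\ge 0$ integers, and let $X_1,\dots,X_n$ be i.i.d. with a probability density $f$ with respect to $\mu$; $\mathbf E_f$ denotes the expectation with respect to this sample. Let $L,R,\tau>0$ and let $\phi_1,\dots,\phi_M:\mathcal X\to\mathbb R$ be measurable functions with $\|\phi_j\|_{L^2(\mu)}=1$ and $\|\phi_j\|_{L^\infty(\mu)}\le L$ for all $j$; assume also $\|f\|_{L^\infty(\mu)}\le L$. For $\lambda\in\mathbb R^M$ put $f_\lambda=\sum_{j=1}^M\lambda_j\phi_j$ and $\|\lambda\|_1=\sum_{j=1}^M|\lambda_j|$. The sparsity prior is the probability measure on $\mathbb R^M$ $$\pi(d\lambda)=\frac1{C_{\tau,R}}\Big\{\prod_{j=1}^M(\tau^2+\lambda_j^2)^{-2}\Big\}\mathbf 1(\|\lambda\|_1\le R)\,d\lambda .$$ With $Q(x,g)=\|g\|_{L^2(\mu)}^2-2g(x)$ and a real parameter $\beta$, the mirror averaging (MA) aggregate is $$\hat f_n(x)=\int f_\lambda(x)\,\frac1{n+1}\sum_{m=0}^n\hat\theta_{m,\lambda}\,\pi(d\lambda),\qquad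 \hat\theta_{m,\lambda}=\frac{\exp\{-\frac1\beta\sum_{i=1}^mQ(X_i,f_\lambda)\}}{\int\exp\{-\frac1\beta\sum_{i=1}^mQ(X_i,f_w)\}\,\pi(dw)} .$$ If $\beta$ satisfies $$(\beta-2R^2)\,e^{-4R(L+\sqrt L)/\beta}\ \ge\ 2L+4RL,$$ then $\|\hat f_n-f\|_{L^2(\mu)}^2$ is a measurable function of the sample and $$\mathbf E_f\big[\|\hat f_n-f\|_{L^2(\mu)}^2\big]\le\inf_{\lambda^*}\Big\{\|f_{\lambda^*}-f\|_{L^2(\mu)}^2+\frac{4\beta}{n+1}\sum_{j=1}^M\log\big(1+\tau^{-1}|\lambda_j^*|\big)\Big\}+4\tau^2M+\frac{\beta}{n+1},$$ where the infimum is over all $\lambda^*\in\mathbb R^M$ with $\|\lambda^*\|_1\le R-2M\tau$ (and is $+\infty$ if there are none). -/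

import Mathlib

open MeasureTheory
open scoped ENNReal

noncomputable section

namespace MirrorAveraging

/-- The linear combination `f_w = ∑ j, w j • φ j` of the elements of the dictionary `φ`. -/
def combination {X : Type*} {M : ℕ} (φ : Fin M → X → ℝ) (w : Fin M → ℝ) (x : X) : ℝ :=
  ∑ j, w j * φ j x

/-- The `ℓ¹` norm on `ℝ^M`. -/
def l1Norm {M : ℕ} (w : Fin M → ℝ) : ℝ := ∑ j, |w j|

/-- The integrated squared loss `‖g - f‖²` in `L²(μ)`, with values in `[0, ∞]`. -/
def sqLoss {X : Type*} [MeasurableSpace X] (μ : Measure X) (g f : X → ℝ) : ℝ≥0∞ :=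
  ∫⁻ x, ENNReal.ofReal ((g x - f x) ^ 2) ∂μ

/-- The contrast `Q(x, g) = ‖g‖² - 2 g(x)`, the norm being that of `L²(μ)`. -/
def contrast {X : Type*} [MeasurableSpace X] (μ : Measure X) (x : X) (g : X → ℝ) : ℝ :=
  (∫ y, g y ^ 2 ∂μ) - 2 * g x

/-- The sparsity prior before normalization: the measure on `ℝ^M` with Lebesgue density
`∏ j, (τ² + w_j²)⁻²` on the `ℓ¹` ball of radius `R`, and zero outside this ball. -/
def unnormalizedPrior (M : ℕ) (τ R : ℝ) : Measure (Fin M → ℝ) :=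
  ((volume : Measure (Fin M → ℝ)).restrict {w | l1Norm w ≤ R}).withDensity
    fun w => ENNReal.ofReal (∏ j, ((τ ^ 2 + w j ^ 2) ^ 2)⁻¹)

/-- The sparsity prior: the normalized version of `unnormalizedPrior`, a probability measure
as soon as `τ` and `R` are positive. -/
def sparsityPrior (M : ℕ) (τ R : ℝ) : Measure (Fin M → ℝ) :=
  (unnormalizedPrior M τ R Set.univ)⁻¹ • unnormalizedPrior M τ R

/-- The exponential weight `exp (-(1/β) ∑_{i ≤ m} Q(Z_i, f_w))`, computed from the first `m`
observations. -/
def expWeight {X : Type*} [MeasurableSpace X] (μ : Measure X) {M n : ℕ} (φ : Fin M → X → ℝ)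
    (β : ℝ) (Z : Fin n → X) (m : ℕ) (w : Fin M → ℝ) : ℝ :=
  Real.exp (-(1 / β) * ∑ i ∈ Finset.univ.filter (fun i : Fin n => (i : ℕ) < m),
    contrast μ (Z i) (combination φ w))

/-- The posterior density `θ_{m,w}(Z)` with respect to the prior `π`, based on the first `m`
observations. -/
def posteriorDensity {X : Type*} [MeasurableSpace X] (μ : Measure X) {M n : ℕ}
    (φ : Fin M → X → ℝ) (π : Measure (Fin M → ℝ)) (β : ℝ) (Z : Fin n → X) (m : ℕ)
    (w : Fin M → ℝ) : ℝ :=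
  expWeight μ φ β Z m w / ∫ v, expWeight μ φ β Z m v ∂π

/-- The averaged posterior density `θ_w(Z) = (n + 1)⁻¹ ∑_{m = 0}^n θ_{m,w}(Z)`. -/
def averagedDensity {X : Type*} [MeasurableSpace X] (μ : Measure X) {M n : ℕ}
    (φ : Fin M → X → ℝ) (π : Measure (Fin M → ℝ)) (β : ℝ) (Z : Fin n → X)
    (w : Fin M → ℝ) : ℝ :=
  1 / ((n : ℝ) + 1) * ∑ m ∈ Finset.range (n + 1), posteriorDensity μ φ π β Z m w

/-- The mirror averaging aggregate `x ↦ ∫ f_w(x) θ_w(Z) π(dw)`. -/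
def maAggregate {X : Type*} [MeasurableSpace X] (μ : Measure X) {M n : ℕ}
    (φ : Fin M → X → ℝ) (π : Measure (Fin M → ℝ)) (β : ℝ) (Z : Fin n → X) (x : X) : ℝ :=
  ∫ w, combination φ w x * averagedDensity μ φ π β Z w ∂π

end MirrorAveraging

end

/-! Up to the constant `‖f‖²`, the risk of `f_v` is the expectation of `Q(X, f_v)`
(`risk_eq_integral_contrast`). The aggregate is the average of the `n + 1` posterior means, and the
risk is convex (`risk_average_le`), so it suffices to bound the mean risk of these posterior means.

One step: let `θ` be a probability measure on the `ℓ¹` ball with mean `v`. The claim `E Q(X, f_v) ≤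
-β E log ∫ exp(-Q(X, f_w)/β) θ(dw)` follows from `log y ≤ y - 1` once `∫ E exp((Q(X, f_v) - Q(X,
f_w))/β) θ(dw) ≤ 1`. The inner expectation lies below its tangent at `w = v`, and the tangent
integrates to 1 because `v` is the mean of `θ`. The tangent bound comes from concavity on segments
from `v`: with `h = f_w - v`, meaning the combination with coefficients `w - v`, and `g` the current
point, the sign of the second derivative reduces to `∫ (h - ⟨g, h⟩)² ω dP ≤ (β/2) ‖h‖² ∫ ω dP`,
where `ω = exp(2th/β)` is the tilt. This is `weighted_variance_le`. It needs a bound `ℓ` on the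
density of the tilted law and one of three relations between `ℓ`, `R`, `L` and `β/2`. The
temperature condition supplies them: Jensen's inequality suffices for `L ≥ 1`, while `L < 1` needs
the elementary but delicate `temperature_alternatives`.

Sum over steps: the posterior after `m` observations predicts a fresh one. Inserted at place `m` of
an `(n+1)`-sample, that observation turns the step bound into a difference of log-partition
functions, and the sum telescopes to `-β E log ∫ exp(-∑ Q/β) dπ` over `n + 1` observations; hence
the denominator `n + 1`.

Prior mass: a copy of the prior with radius `2Mτ`, translated to `λ*`, is dominated by `π` with
factor `e ∏ (1 + |λ*_j|/τ)^4`, and Jensen's inequality under this copy bounds the log-partition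
function. By symmetry, the noise adds only the second moments of its coordinates, at most `4τ²`
each. The factor gives the logarithms and the term `β/(n+1)`. -/

namespace MirrorAveraging

/-! ### Algebra of the temperature condition for `L < 1` -/

/-- The polynomial inequalities behind `temperature_alternatives`. -/
lemma temperature_polynomial_contradiction {a q R B b D : ℝ} (ha0 : 0 < a) (ha1 : a < 1)
    (hR : 0 < R) (hB0 : 0 < B) (hq0 : 0 < q) (haq : a ≤ q) (hbpos : 0 < b) (hbsq : b ^ 2 = B)
    (hD0 : 0 < D) (hDB : D * B = 2 * (1 + 2 * R) * q ^ 2 * (a - a ^ 2))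
    (hb : B < (R + a ^ 2) ^ 2 + q ^ 2) (hc : B < q ^ 2 + R * a ^ 2 + R * b)
    (h4 : R + 2 * q ^ 2 + D - a ^ 2 < b) (h8 : 4 * R ^ 2 * (1 + a) < a * B)
    (hq32 : a ≤ 3 / 5 → q ≤ 3 / 2 * a) : False := by
  have hqa2 : a ^ 2 ≤ q ^ 2 := by gcongr
  -- Here `hc` reads `b (b - R) < q² + R a²` since `b² = B`, and `h4` bounds `b - R` below by `2q² -
  -- a² + D`.
  have h5 : (2 * q ^ 2 - a ^ 2 + D) ^ 2 < q ^ 2 := by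
    have h51 : b * (b - R) < q ^ 2 + R * a ^ 2 := by linarith [mul_sub b b R, pow_two b, mul_comm b R]
    have h52 : (R + 2 * q ^ 2 - a ^ 2 + D) * (2 * q ^ 2 - a ^ 2 + D) ≤ b * (b - R) :=
      mul_le_mul (by linarith) (by linarith)
        (by linarith [sq_nonneg q]) hbpos.le
    linarith [mul_pos hR hD0, mul_nonneg hR.le (sub_nonneg.2 hqa2)]
  have h6 : q ^ 2 + D < q := by
    have : 2 * q ^ 2 - a ^ 2 + D < q := lt_of_pow_lt_pow_left₀ 2 hq0.le h5
    linarith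
  have hq1 : q < 1 := by nlinarith
  have h7 : 2 * (1 + 2 * R) * q * (a * (1 - a)) < (1 - q) * B := by
    have : q * (2 * (1 + 2 * R) * q * (a * (1 - a))) < q * ((1 - q) * B) := by
      linarith [mul_lt_mul_of_pos_right h6 hB0]
    exact lt_of_mul_lt_mul_left this hq0.le
  -- Follows from `h8` and `2a ≤ 1 + a`. It makes `R²` a small part of `B`, so `hb` becomes an upper
  -- bound on `B` to be set against `h7`.
  have h9 : 8 * R ^ 2 < B := by
    have : a * B * 2 ≤ (1 + a) * B := by nlinarith
    have : (1 + a) * (8 * R ^ 2) < (1 + a) * B := by nlinarith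
    exact lt_of_mul_lt_mul_left this (by linarith)
  -- For small `a`, `q` is comparable to `a`. For large `a`, `R ≤ 2a²`, so `R²` is absorbed by `2 R
  -- a²`; then the terms carrying `R` cancel by `h12`.
  rcases le_total a (3 / 5) with ha | ha
  · replace hq32 := hq32 ha
    have h10 : B * 7 / 8 < 2 * R * a ^ 2 + a ^ 4 + q ^ 2 := by linarith
    have h11 : (1 - q) * B ≤ (1 - q) * (8 / 7 * (2 * R * a ^ 2 + a ^ 4 + q ^ 2)) := by
      gcongr
      linarith
    have h12 : (1 - q) * a ^ 2 ≤ (1 - a) * (q * a) := by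
      apply mul_le_mul (by linarith) (by nlinarith) (by positivity) (by linarith)
    have h13 : (1 - q) * (a ^ 4 + q ^ 2) ≤ (1 - a) * (a ^ 4 + q ^ 2) := by gcongr
    have h14 : (1 - a) * (7 / 4 * (q * a)) < (1 - a) * (a ^ 4 + q ^ 2) := by
      linarith [mul_le_mul_of_nonneg_left h12 hR.le,
        mul_nonneg hR.le (mul_nonneg (sub_nonneg.2 ha1.le) (mul_nonneg hq0.le ha0.le))]
    have h15 := lt_of_mul_lt_mul_left h14 (by linarith)
    have h16 : a ^ 4 ≤ 9 / 25 * a ^ 2 := by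
      have : a ^ 2 ≤ (3 / 5) ^ 2 := by gcongr
      linarith [mul_le_mul_of_nonneg_left this (sq_nonneg a)]
    linarith [mul_le_mul_of_nonneg_right hq32 ha0.le, pow_pos ha0 2, mul_nonneg (sub_nonneg.2 haq) (sub_nonneg.2 hq32)]
  · clear hc h4 h5 h6 hDB hq32 hbsq
    have hR2 : R ≤ 18 / 25 := by
      by_contra! h
      have h1 : a ^ 2 < 1 := pow_lt_one₀ ha0.le ha1 (by norm_num)
      have h2 : a ^ 4 < 1 := pow_lt_one₀ ha0.le ha1 (by norm_num)
      have h3 : q ^ 2 < 1 := pow_lt_one₀ hq0.le hq1 (by norm_num)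
      linarith [mul_pos hR (sub_pos.2 h1), mul_lt_mul_of_pos_right h hR]
    have hR3 : R ≤ 2 * a ^ 2 := by nlinarith
    have h11 : (1 - q) * B ≤ (1 - q) * (4 * R * a ^ 2 + a ^ 4 + q ^ 2) := by
      gcongr
      linarith [mul_le_mul_of_nonneg_left hR3 hR.le]
    have h12 : (1 - q) * a ^ 2 ≤ (1 - a) * (q * a) := by
      apply mul_le_mul (by linarith) (by nlinarith) (by positivity) (by linarith)
    have h13 : 2 * q * a * (1 - a) < (1 - q) * (a ^ 4 + q ^ 2) := by
      linarith [mul_le_mul_of_nonneg_left h12 hR.le]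
    have h14 : 0 ≤ a - a ^ 2 + a ^ 4 + q * (q + a - 1) := by
      have : 0 ≤ q * (q + a - 1) := mul_nonneg hq0.le (by linarith)
      linarith [mul_nonneg ha0.le (sub_nonneg.2 ha1.le), pow_pos ha0 4]
    -- The difference vanishes to first order at `q = a` up to the explicit first term; both terms
    -- on the right are nonnegative, contradicting `h13`.
    have h15 : 2 * q * a * (1 - a) - (1 - q) * (a ^ 4 + q ^ 2)
        = (1 - a) * a ^ 2 * (1 - a ^ 2)
          + (q - a) * (a - a ^ 2 + a ^ 4 + q * (q + a - 1)) := by ring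
    have h16 : 0 ≤ (1 - a) * a ^ 2 * (1 - a ^ 2) :=
      mul_nonneg (mul_nonneg (by linarith) (sq_nonneg a))
        (sub_nonneg.2 (pow_lt_one₀ ha0.le ha1 (by norm_num)).le)
    linarith [mul_nonneg (sub_nonneg.2 haq) h14]


/-- When `L < 1`, the condition on the temperature yields one of two algebraic inequalities. -/
lemma temperature_alternatives {L R B : ℝ} (hL0 : 0 < L) (hL1 : L < 1) (hR : 0 < R)
    (hB : R ^ 2 + (L + 2 * R * L) * Real.exp (2 * R * (L + √L) / B) ≤ B) :
    (R + L) ^ 2 + L * Real.exp (4 * R * L / B) ≤ B ∨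
      L * Real.exp (4 * R * L / B) + R * L + R * √B ≤ B := by
  have hB0 : 0 < B := lt_of_lt_of_le (by positivity) hB
  by_contra! hcon
  obtain ⟨hb, hc⟩ := hcon
  obtain ⟨a, ha0, rfl⟩ : ∃ a : ℝ, 0 < a ∧ a ^ 2 = L :=
    ⟨√L, Real.sqrt_pos.2 hL0, Real.sq_sqrt hL0.le⟩
  rw [Real.sqrt_sq ha0.le] at hB
  have ha1 : a < 1 := by nlinarith
  have hbsq : √B ^ 2 = B := Real.sq_sqrt hB0.le
  have hbpos : 0 < √B := Real.sqrt_pos.2 hB0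
  set b := √B
  set K' := Real.exp (2 * R * (a ^ 2 + a) / B) with hK'
  set K := Real.exp (4 * R * a ^ 2 / B) with hK
  have haL : 0 < a - a ^ 2 := by nlinarith
  have hK1 : 1 ≤ K := Real.one_le_exp (by positivity)
  have hK'1 : 1 + 2 * R * (a ^ 2 + a) / B ≤ K' := by
    have := Real.add_one_le_exp (2 * R * (a ^ 2 + a) / B)
    linarith
  -- The exponents of `K'` and `K` differ by `2R(a - a²)/B > 0`: this gap, kept to first order, is
  -- the slack `D` below.
  have hK'K : K * (1 + 2 * R * (a - a ^ 2) / B) ≤ K' := by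
    have h1 : K' = K * Real.exp (2 * R * (a - a ^ 2) / B) := by
      rw [hK, hK', ← Real.exp_add]; congr 1; ring
    have := Real.add_one_le_exp (2 * R * (a - a ^ 2) / B)
    rw [h1]
    gcongr
    linarith
  have hδ : 0 < 2 * R * (a - a ^ 2) / B := by positivity
  -- The failed alternative `hb` compared with `hB`, the exponentials being bounded below by their
  -- tangents at zero.
  have h3 : 2 * R * (a - a ^ 2) + 4 * R ^ 2 * (a ^ 2 + a) < a ^ 2 * B := by
    have h31 : (K' - K) + 2 * R * (K' - 1) < a ^ 2 := by
      have : a ^ 2 * ((K' - K) + 2 * R * (K' - 1)) < a ^ 2 * a ^ 2 := by nlinarith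
      exact lt_of_mul_lt_mul_left this (by positivity)
    have h32 : 2 * R * (a - a ^ 2) / B + 2 * R * (2 * R * (a ^ 2 + a) / B) < a ^ 2 := by
      have : 2 * R * (2 * R * (a ^ 2 + a) / B) ≤ 2 * R * (K' - 1) := by gcongr; linarith
      nlinarith
    have h33 : (2 * R * (a - a ^ 2) / B + 2 * R * (2 * R * (a ^ 2 + a) / B)) * B
        = 2 * R * (a - a ^ 2) + 4 * R ^ 2 * (a ^ 2 + a) := by field_simp; ring
    nlinarith
  have hBL : R ^ 2 + a ^ 2 + 2 * R * a ^ 2 ≤ B := by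
    have : (1 : ℝ) ≤ K' := by nlinarith
    nlinarith [mul_le_mul_of_nonneg_left this (by positivity : (0 : ℝ) ≤ a ^ 2 + 2 * R * a ^ 2)]
  obtain ⟨q, hq0, hq⟩ : ∃ q : ℝ, 0 < q ∧ q ^ 2 = a ^ 2 * K :=
    ⟨√(a ^ 2 * K), Real.sqrt_pos.2 (by positivity), Real.sq_sqrt (by positivity)⟩
  rw [← hq] at hb hc
  have haq : a ≤ q := by
    have : a ^ 2 ≤ q ^ 2 := by rw [hq]; nlinarith
    exact le_of_sq_le_sq this hq0.le
  set D := 2 * (1 + 2 * R) * q ^ 2 * (a - a ^ 2) / B with hD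
  have hD0 : 0 < D := by positivity
  have hDB : D * B = 2 * (1 + 2 * R) * q ^ 2 * (a - a ^ 2) := by rw [hD]; field_simp
  -- The failed alternative `hc` compared with `hB`; after cancelling `q²`, everything is divisible
  -- by `R`.
  have h4 : R + 2 * q ^ 2 + D - a ^ 2 < b := by
    have h41 : (1 + 2 * R) * q ^ 2 + R * D ≤ (a ^ 2 + 2 * R * a ^ 2) * K' := by
      have : (1 + 2 * R) * q ^ 2 + R * D
          = (a ^ 2 + 2 * R * a ^ 2) * (K * (1 + 2 * R * (a - a ^ 2) / B)) := by
        rw [hD, hq]; field_simp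
      rw [this]; gcongr
    have : R * (R + 2 * q ^ 2 + D - a ^ 2) < R * b := by nlinarith
    exact lt_of_mul_lt_mul_left this hR.le
  have h8 : 4 * R ^ 2 * (1 + a) < a * B := by
    have : a * (4 * R ^ 2 * (1 + a)) < a * (a * B) := by nlinarith [mul_pos hR haL]
    exact lt_of_mul_lt_mul_left this ha0.le
  refine temperature_polynomial_contradiction ha0 ha1 hR hB0 hq0 haq hbpos hbsq hD0 hDB hb hc h4 h8
    fun ha => ?_
  -- `h8` and `B ≥ a²` make the exponent of `K` at most `3/4`; then `K ≤ e^(3/4) ≤ 9/4`, whose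
  -- square root is the `3/2` required.
  have hx : 4 * R * a ^ 2 / B ≤ 3 / 4 := by
    rw [div_le_iff₀ hB0]
    refine le_of_sq_le_sq ?_ (by positivity)
    have h1 : R ^ 2 * 4 ≤ a * B := by nlinarith [mul_pos (pow_pos hR 2) ha0]
    have h2 : a ^ 2 ≤ B := by linarith [mul_pos hR hL0, sq_nonneg R]
    have h3 : 4 * R ^ 2 * (1 + a) * a ^ 4 ≤ a * B * a ^ 4 := by gcongr
    have h4 : a * B * a ^ 4 * 4 ≤ a ^ 3 * 4 * (B * B) := by
      linarith [mul_le_mul_of_nonneg_left h2 (by positivity : (0:ℝ) ≤ a ^ 3 * B)]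
    have h5 : a ^ 3 * 4 ≤ (3 / 4) ^ 2 * (1 + a) := by
      have h51 : a ^ 2 ≤ (3 / 5) ^ 2 := by gcongr
      have h52 := mul_le_mul_of_nonneg_left h51 ha0.le
      linarith [pow_succ' a 2]
    have h6 : a ^ 3 * 4 * (B * B) ≤ (3 / 4) ^ 2 * (1 + a) * (B * B) := by gcongr
    have : (1 + a) * (4 * R * a ^ 2) ^ 2 ≤ (1 + a) * (3 / 4 * B) ^ 2 := by
      have h7 := mul_le_mul_of_nonneg_left h1 (by positivity : 0 ≤ a ^ 4 * (1 + a) * 4)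
      linarith
    exact le_of_mul_le_mul_left this (by linarith)
  have hK94 : K ≤ 9 / 4 := by
    have h1 : K ≤ Real.exp (3 / 4) := Real.exp_le_exp.2 hx
    have h2 : Real.exp (3 / 4) ≤ 9 / 4 := by
      refine le_of_pow_le_pow_left₀ (n := 4) (by norm_num) (by norm_num) ?_
      rw [← Real.exp_nat_mul]
      have : ((4 : ℕ) : ℝ) * (3 / 4) = ((3 : ℕ) : ℝ) * 1 := by norm_num
      rw [this, Real.exp_nat_mul]
      have h3 := Real.exp_one_lt_d9
      calc Real.exp 1 ^ 3 ≤ (2.7182818286 : ℝ) ^ 3 := by gcongr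
        _ ≤ _ := by norm_num
    linarith
  refine le_of_sq_le_sq ?_ (by positivity)
  rw [hq]
  linarith [mul_le_mul_of_nonneg_left hK94 (sq_nonneg a)]

end MirrorAveraging

/-! ### Laws with bounded density and the weighted variance bound -/

namespace MirrorAveraging

variable {X : Type*} [MeasurableSpace X] {μ P : Measure X}

/-- Three functions are allowed because one case of `weighted_variance_le` expands a combination of
`h`, `g` and a density; other uses set a coefficient to zero. -/
lemma integral_sq_linear_combination {u v w : X → ℝ} (hu : MemLp u 2 μ) (hv : MemLp v 2 μ)
    (hw : MemLp w 2 μ) (a b c : ℝ) :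
    ∫ x, (a * u x + b * v x + c * w x) ^ 2 ∂μ =
      a ^ 2 * (∫ x, u x ^ 2 ∂μ) + b ^ 2 * (∫ x, v x ^ 2 ∂μ) + c ^ 2 * (∫ x, w x ^ 2 ∂μ)
        + 2 * a * b * (∫ x, u x * v x ∂μ) + 2 * a * c * (∫ x, u x * w x ∂μ)
        + 2 * b * c * (∫ x, v x * w x ∂μ) := by
  have huv : Integrable (fun x => u x * v x) μ := hu.integrable_mul hv
  have huw : Integrable (fun x => u x * w x) μ := hu.integrable_mul hw
  have hvw : Integrable (fun x => v x * w x) μ := hv.integrable_mul hw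
  have h1 : ∀ x, (a * u x + b * v x + c * w x) ^ 2
      = a ^ 2 * u x ^ 2 + b ^ 2 * v x ^ 2 + c ^ 2 * w x ^ 2 + 2 * a * b * (u x * v x)
        + 2 * a * c * (u x * w x) + 2 * b * c * (v x * w x) := fun x => by ring
  simp_rw [h1]
  have iu := hu.integrable_sq
  have iv := hv.integrable_sq
  have iw := hw.integrable_sq
  rw [integral_add (by fun_prop) (by fun_prop), integral_add (by fun_prop) (by fun_prop),
    integral_add (by fun_prop) (by fun_prop), integral_add (by fun_prop) (by fun_prop),
    integral_add (by fun_prop) (by fun_prop)]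
  simp only [integral_const_mul]

/-- Cauchy–Schwarz by the discriminant of `t ↦ ‖t u + v‖²`. -/
lemma sq_integral_mul_le {u v : X → ℝ} (hu : MemLp u 2 μ) (hv : MemLp v 2 μ) :
    (∫ x, u x * v x ∂μ) ^ 2 ≤ (∫ x, u x ^ 2 ∂μ) * ∫ x, v x ^ 2 ∂μ := by
  have h : ∀ t : ℝ, 0 ≤ (∫ x, u x ^ 2 ∂μ) * (t * t) + (2 * ∫ x, u x * v x ∂μ) * t
      + ∫ x, v x ^ 2 ∂μ := fun t => by
    have h1 := integral_sq_linear_combination hu hv hv t 1 0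
    have h2 : 0 ≤ ∫ x, (t * u x + 1 * v x + 0 * v x) ^ 2 ∂μ :=
      integral_nonneg fun x => sq_nonneg _
    rw [h1] at h2
    linarith
  have := discrim_le_zero h
  unfold discrim at this
  linarith

/-- `P` is the probability measure with density `f` with respect to `μ`, and `f ≤ L`. -/
structure HasBoundedDensity (μ P : Measure X) (f : X → ℝ) (L : ℝ) : Prop where
  measurable : Measurable f
  nonneg : 0 ≤ᵐ[μ] f
  le : ∀ᵐ x ∂μ, f x ≤ L
  eq_withDensity : P = μ.withDensity fun x => ENNReal.ofReal (f x)
  isProbabilityMeasure : IsProbabilityMeasure P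

namespace HasBoundedDensity

variable {f : X → ℝ} {L : ℝ}

lemma le_smul (hP : HasBoundedDensity μ P f L) : P ≤ ENNReal.ofReal L • μ := by
  rw [hP.eq_withDensity, ← withDensity_const]
  refine withDensity_mono ?_
  filter_upwards [hP.le] with x hx using ENNReal.ofReal_le_ofReal hx

lemma absolutelyContinuous (hP : HasBoundedDensity μ P f L) : P ≪ μ := by
  rw [hP.eq_withDensity]; exact withDensity_absolutelyContinuous _ _

lemma integral_eq (hP : HasBoundedDensity μ P f L) (u : X → ℝ) :
    ∫ x, u x ∂P = ∫ x, f x * u x ∂μ := by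
  rw [hP.eq_withDensity, integral_withDensity_eq_integral_toReal_smul
    hP.measurable.ennreal_ofReal (by simp)]
  refine integral_congr_ae ?_
  filter_upwards [hP.nonneg] with x hx
  rw [ENNReal.toReal_ofReal hx, smul_eq_mul]

lemma memLp (hP : HasBoundedDensity μ P f L) : MemLp f 2 μ := by
  have hfi : Integrable f μ := by
    refine ⟨hP.measurable.aestronglyMeasurable, ?_⟩
    have h1 := hP.isProbabilityMeasure.measure_univ
    rw [hP.eq_withDensity, withDensity_apply _ MeasurableSet.univ, Measure.restrict_univ] at h1
    rw [hasFiniteIntegral_iff_ofReal hP.nonneg, h1]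
    exact ENNReal.one_lt_top
  refine (memLp_two_iff_integrable_sq hP.measurable.aestronglyMeasurable).2 ?_
  refine (hfi.const_mul L).mono' (hP.measurable.pow_const 2).aestronglyMeasurable ?_
  filter_upwards [hP.nonneg, hP.le] with x hx hx'
  have hx0 : 0 ≤ f x := hx
  rw [Real.norm_of_nonneg (sq_nonneg _)]
  nlinarith

lemma memLp_two (hP : HasBoundedDensity μ P f L) {u : X → ℝ} (hu : MemLp u 2 μ) :
    MemLp u 2 P :=
  hu.of_measure_le_smul ENNReal.ofReal_ne_top hP.le_smul

lemma integral_sq_le (hP : HasBoundedDensity μ P f L) (hL : 0 ≤ L) {u : X → ℝ}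
    (hu : MemLp u 2 μ) : ∫ x, u x ^ 2 ∂P ≤ L * ∫ x, u x ^ 2 ∂μ := by
  have h := integral_mono_measure (f := fun x => u x ^ 2) hP.le_smul
    (Filter.Eventually.of_forall fun x => sq_nonneg _)
    (hu.integrable_sq.smul_measure ENNReal.ofReal_ne_top)
  rwa [integral_smul_measure, ENNReal.toReal_ofReal hL, smul_eq_mul] at h

lemma sq_integral_le (hP : HasBoundedDensity μ P f L) (hL : 0 ≤ L) {u : X → ℝ}
    (hu : MemLp u 2 μ) : (∫ x, u x ∂P) ^ 2 ≤ L * ∫ x, u x ^ 2 ∂μ := by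
  have := hP.isProbabilityMeasure
  have h := sq_integral_mul_le (memLp_const (1 : ℝ)) (hP.memLp_two hu)
  simp only [one_mul, one_pow, integral_const, probReal_univ, smul_eq_mul, mul_one] at h
  exact h.trans (hP.integral_sq_le hL hu)

variable {ω : X → ℝ} {C ℓ : ℝ}

lemma integrable_weight (hP : HasBoundedDensity μ P f L) (hω : Measurable ω)
    (hω0 : ∀ x, 0 < ω x) (hωC : ∀ x, ω x ≤ C) : Integrable ω P := by
  have := hP.isProbabilityMeasure
  refine Integrable.of_bound hω.aestronglyMeasurable C (.of_forall fun x => ?_)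
  rw [Real.norm_of_nonneg (hω0 x).le]
  exact hωC x

lemma integral_weight_pos (hP : HasBoundedDensity μ P f L) (hω : Measurable ω)
    (hω0 : ∀ x, 0 < ω x) (hωC : ∀ x, ω x ≤ C) : 0 < ∫ x, ω x ∂P := by
  have := hP.isProbabilityMeasure
  rw [integral_pos_iff_support_of_nonneg (fun x => (hω0 x).le)
    (hP.integrable_weight hω hω0 hωC)]
  have : Function.support ω = Set.univ := by
    ext x; simp [(hω0 x).ne']
  simp [this]

lemma integrable_mul_weight (hω : Measurable ω)
    (hω0 : ∀ x, 0 < ω x) (hωC : ∀ x, ω x ≤ C) {u : X → ℝ} (hu : Integrable u P) :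
    Integrable (fun x => u x * ω x) P := by
  have h : Integrable (fun x => ω x * u x) P := by
    refine hu.bdd_mul (c := C) hω.aestronglyMeasurable (.of_forall fun x => ?_)
    rw [Real.norm_of_nonneg (hω0 x).le]
    exact hωC x
  simpa only [mul_comm] using h

/-- The measure `ω dP` has density `ω f ≤ ω L ≤ ℓ ∫ ω dP` with respect to `μ`. -/
lemma integral_sq_mul_weight_le (hP : HasBoundedDensity μ P f L) (hL : 0 < L) (hℓ : 0 ≤ ℓ)
    (hω : Measurable ω) (hω0 : ∀ x, 0 < ω x) (hωC : ∀ x, ω x ≤ C)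
    (hωℓ : ∀ x, L * ω x ≤ ℓ * ∫ y, ω y ∂P) {u : X → ℝ} (hu : MemLp u 2 μ) :
    ∫ x, u x ^ 2 * ω x ∂P ≤ ℓ * (∫ y, ω y ∂P) * ∫ x, u x ^ 2 ∂μ := by
  have hu2 := (hP.memLp_two hu).integrable_sq
  have h1 : ∫ x, u x ^ 2 * ω x ∂P ≤ ∫ x, (ℓ * (∫ y, ω y ∂P) / L) * u x ^ 2 ∂P := by
    refine integral_mono (integrable_mul_weight hω hω0 hωC hu2) (hu2.const_mul _) fun x => ?_
    have : ω x ≤ ℓ * (∫ y, ω y ∂P) / L := by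
      rw [le_div_iff₀ hL]; linarith [hωℓ x]
    dsimp only
    rw [mul_comm]
    gcongr
  rw [integral_const_mul] at h1
  have hN : 0 ≤ ℓ * (∫ y, ω y ∂P) / L := by
    have := hP.integral_weight_pos hω hω0 hωC
    positivity
  calc _ ≤ _ := h1
    _ ≤ ℓ * (∫ y, ω y ∂P) / L * (L * ∫ x, u x ^ 2 ∂μ) := by
        gcongr; exact hP.integral_sq_le hL.le hu
    _ = _ := by field_simp

/-- The variance bound behind the concavity of the exponential moments of the contrast. -/
lemma weighted_variance_le (hP : HasBoundedDensity μ P f L) (hL : 0 < L) (hℓ : 0 < ℓ)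
    (hω : Measurable ω) (hω0 : ∀ x, 0 < ω x) (hωC : ∀ x, ω x ≤ C)
    (hωℓ : ∀ x, L * ω x ≤ ℓ * ∫ y, ω y ∂P) {g h : X → ℝ} (hg : MemLp g 2 μ) (hh : MemLp h 2 μ)
    {R B : ℝ} (hR : 0 < R) (hgR : ∫ x, g x ^ 2 ∂μ ≤ R ^ 2) (hgb : ∀ x, |g x| ≤ R * L)
    (hB : (√ℓ + R) ^ 2 ≤ B ∨ (R + L) ^ 2 + ℓ ≤ B ∨ ℓ + R * L + R * √B ≤ B) :
    ∫ x, (h x - ∫ y, g y * h y ∂μ) ^ 2 * ω x ∂P ≤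
      B * (∫ x, h x ^ 2 ∂μ) * ∫ x, ω x ∂P := by
  have := hP.isProbabilityMeasure
  have hN := hP.integral_weight_pos hω hω0 hωC
  have hsq := fun {u : X → ℝ} (hu : MemLp u 2 μ) =>
    hP.integral_sq_mul_weight_le hL hℓ.le hω hω0 hωC hωℓ hu
  have hωi := hP.integrable_weight hω hω0 hωC
  have hmulω := fun {u : X → ℝ} (hu : Integrable u P) => integrable_mul_weight hω hω0 hωC hu
  set c := ∫ y, g y * h y ∂μ with hc
  set N := ∫ y, ω y ∂P with hNdef
  set y := ∫ x, h x ^ 2 ∂μ with hy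
  have hy0 : 0 ≤ y := integral_nonneg fun x => sq_nonneg _
  have hcsq : c ^ 2 ≤ R ^ 2 * y :=
    (sq_integral_mul_le hg hh).trans (by gcongr)
  have hleft : Integrable (fun x => (h x - c) ^ 2 * ω x) P :=
    hmulω ((hP.memLp_two hh).sub (memLp_const c)).integrable_sq
  rcases hB with hB | hB | hB
  · have hq : 0 < √ℓ := Real.sqrt_pos.2 hℓ
    have hqℓ : √ℓ ^ 2 = ℓ := Real.sq_sqrt hℓ.le
    set q := √ℓ
    -- Young's inequality with weights `R/q` and `q/R`, optimal for the bounds `q ‖h‖` and `R ‖h‖`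
    -- on the two parts: in effect Minkowski's inequality.
    have h1 : ∫ x, (h x - c) ^ 2 * ω x ∂P
        ≤ ∫ x, ((1 + R / q) * (h x ^ 2 * ω x) + ((1 + q / R) * c ^ 2) * ω x) ∂P := by
      refine integral_mono hleft (((hmulω (hP.memLp_two hh).integrable_sq).const_mul _).add
        (hωi.const_mul _)) fun x => ?_
      have h2 : (h x - c) ^ 2 ≤ (1 + R / q) * h x ^ 2 + (1 + q / R) * c ^ 2 := by
        have h3 : (1 + R / q) * h x ^ 2 + (1 + q / R) * c ^ 2 - (h x - c) ^ 2
            = (R * h x + q * c) ^ 2 / (q * R) := by field_simp; ring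
        have h4 : 0 ≤ (R * h x + q * c) ^ 2 / (q * R) := by positivity
        linarith
      have := mul_le_mul_of_nonneg_right h2 (hω0 x).le
      dsimp only
      linarith
    rw [integral_add ((hmulω (hP.memLp_two hh).integrable_sq).const_mul _) (hωi.const_mul _),
      integral_const_mul, integral_const_mul] at h1
    calc _ ≤ _ := h1
      _ ≤ (1 + R / q) * (ℓ * N * y) + (1 + q / R) * (R ^ 2 * y) * N := by
          gcongr
          exact hsq hh
      _ = (q + R) ^ 2 * y * N := by rw [← hqℓ]; field_simp; ring
      _ ≤ _ := by gcongr
  -- Subtracting from `h` a multiple of `g` leaves `‖k‖² ≤ ‖h‖² - c²/R²`, while `h - c = (c/R²)(g -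
  -- R²) + k` with `|g - R²| ≤ R(R + L)` pointwise. The gain in `k` pays exactly for the first term.
  · set k : X → ℝ := fun x => h x - c / R ^ 2 * g x with hk
    have hk2 : MemLp k 2 μ := hh.sub (hg.const_mul _)
    have hky : ∫ x, k x ^ 2 ∂μ ≤ y - c ^ 2 / R ^ 2 := by
      have h1 := integral_sq_linear_combination hh hg hg 1 (-(c / R ^ 2)) 0
      have h2 : ∀ x, 1 * h x + -(c / R ^ 2) * g x + 0 * g x = k x := fun x => by
        simp only [hk]; ring
      simp_rw [h2] at h1
      have h3 : ∫ x, h x * g x ∂μ = c := by simp only [hc, mul_comm]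
      rw [h1, h3, ← hy]
      have h4 : (c / R ^ 2) ^ 2 * ∫ x, g x ^ 2 ∂μ ≤ (c / R ^ 2) ^ 2 * R ^ 2 := by gcongr
      have h5 : (c / R ^ 2) ^ 2 * R ^ 2 = c ^ 2 / R ^ 2 := by field_simp
      have h6 : c / R ^ 2 * c = c ^ 2 / R ^ 2 := by field_simp
      linarith
    set A := (R + L) ^ 2 with hA
    have hA0 : 0 < A := by positivity
    have h1 : ∫ x, (h x - c) ^ 2 * ω x ∂P
        ≤ ∫ x, (((A + ℓ) / ℓ) * (k x ^ 2 * ω x) + ((A + ℓ) * (c ^ 2 / R ^ 2)) * ω x) ∂P := by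
      refine integral_mono hleft (((hmulω (hP.memLp_two hk2).integrable_sq).const_mul _).add
        (hωi.const_mul _)) fun x => ?_
      have h2 : (h x - c) ^ 2 ≤ (A + ℓ) / ℓ * k x ^ 2 + (A + ℓ) * (c ^ 2 / R ^ 2) := by
        set p := c / R ^ 2 * (g x - R ^ 2) with hp
        have hpk : h x - c = p + k x := by simp only [hp, hk]; field_simp; ring
        have hpA : p ^ 2 / A ≤ c ^ 2 / R ^ 2 := by
          have h3 : (g x - R ^ 2) ^ 2 ≤ R ^ 2 * A := by
            rw [hA, ← mul_pow, ← sq_abs]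
            gcongr
            have := abs_sub (g x) (R ^ 2)
            rw [abs_of_pos (pow_pos hR 2)] at this
            linarith [hgb x]
          calc p ^ 2 / A = (c / R ^ 2) ^ 2 * (g x - R ^ 2) ^ 2 / A := by rw [hp]; ring
            _ ≤ (c / R ^ 2) ^ 2 * (R ^ 2 * A) / A := by gcongr
            _ = _ := by field_simp
        -- The Cauchy–Schwarz inequality `(p + k)² ≤ (A + ℓ)(p²/A + k²/ℓ)`, as an explicit square.
        have h4 : (A + ℓ) / ℓ * k x ^ 2 + (A + ℓ) * (p ^ 2 / A) - (p + k x) ^ 2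
            = (A * k x - ℓ * p) ^ 2 / (A * ℓ) := by field_simp; ring
        have h5 : 0 ≤ (A * k x - ℓ * p) ^ 2 / (A * ℓ) := by positivity
        have h6 : (A + ℓ) * (p ^ 2 / A) ≤ (A + ℓ) * (c ^ 2 / R ^ 2) := by gcongr
        rw [hpk]
        linarith
      have := mul_le_mul_of_nonneg_right h2 (hω0 x).le
      dsimp only
      linarith
    rw [integral_add ((hmulω (hP.memLp_two hk2).integrable_sq).const_mul _) (hωi.const_mul _),
      integral_const_mul, integral_const_mul] at h1
    calc _ ≤ _ := h1
      _ ≤ (A + ℓ) / ℓ * (ℓ * N * (y - c ^ 2 / R ^ 2)) + (A + ℓ) * (c ^ 2 / R ^ 2) * N := by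
          gcongr
          exact (hsq hk2).trans (by gcongr)
      _ = (A + ℓ) * y * N := by field_simp; ring
      _ ≤ _ := by gcongr
  -- Now `p` is the `μ`-density of the normalized tilted law, with `‖p‖² ≤ ℓ`. The square is
  -- expanded, and the cross term is read as an inner product with `p`.
  · set p : X → ℝ := fun x => ω x * f x / N with hp
    have hp2 : MemLp p 2 μ := by
      refine hP.memLp.of_le_mul (c := C / N)
        ((hω.mul hP.measurable).div_const N).aestronglyMeasurable (.of_forall fun x => ?_)
      simp only [hp, Real.norm_eq_abs]
      rw [abs_div, abs_mul, abs_of_pos (hω0 x), abs_of_pos hN, div_mul_eq_mul_div]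
      gcongr
      exact hωC x
    have hpint : ∀ u : X → ℝ, ∫ x, u x * p x ∂μ = (∫ x, u x * ω x ∂P) / N := fun u => by
      rw [hP.integral_eq, ← integral_div]
      congr 1 with x
      simp only [hp]; ring
    have hpp : ∫ x, p x ^ 2 ∂μ ≤ ℓ := by
      have h1 : ∫ x, p x ^ 2 ∂μ = (∫ x, p x * ω x ∂P) / N := by
        rw [← hpint]; simp only [pow_two]
      rw [h1, div_le_iff₀ hN, hNdef, ← integral_const_mul]
      refine integral_mono_ae (hmulω ((hP.memLp_two hp2).integrable one_le_two))
        (hωi.const_mul _) ?_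
      filter_upwards [hP.absolutelyContinuous.ae_le hP.le] with x hx
      refine mul_le_mul_of_nonneg_right ?_ (hω0 x).le
      simp only [hp]
      rw [div_le_iff₀ hN]
      nlinarith [hωℓ x, hω0 x, mul_le_mul_of_nonneg_left hx (hω0 x).le]
    set m := ∫ x, h x * p x ∂μ with hm
    set e := ∫ x, g x * p x ∂μ with he
    have hmN : ∫ x, h x * ω x ∂P = m * N := by rw [hm, hpint]; field_simp
    have heR : -(R * L) ≤ e := by
      rw [he, hpint, le_div_iff₀ hN, hNdef, ← integral_const_mul]
      refine integral_mono (hωi.const_mul _)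
        (hmulω ((hP.memLp_two hg).integrable one_le_two)) fun x => ?_
      exact mul_le_mul_of_nonneg_right (neg_le_of_abs_le (hgb x)) (hω0 x).le
    have hexp : ∫ x, (h x - c) ^ 2 * ω x ∂P
        = (∫ x, h x ^ 2 * ω x ∂P) - 2 * c * (m * N) + c ^ 2 * N := by
      have h1 : ∀ x, (h x - c) ^ 2 * ω x
          = h x ^ 2 * ω x - 2 * c * (h x * ω x) + c ^ 2 * ω x := fun x => by ring
      have i1 := hmulω (hP.memLp_two hh).integrable_sq
      have i2 := hmulω ((hP.memLp_two hh).integrable one_le_two)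
      simp_rw [h1]
      rw [integral_add (by fun_prop) (by fun_prop), integral_sub (by fun_prop) (by fun_prop),
        integral_const_mul, integral_const_mul, hmN]
    have hB0 : 0 < B := by
      have := Real.sqrt_nonneg B
      have := mul_nonneg hR.le this
      have := mul_pos hR hL
      linarith
    have hQ : R * L + R * √B ≤ B - ℓ := by linarith
    have hQ0 : 0 < B - ℓ := lt_of_lt_of_le (by positivity) hQ
    have hBsq : √B ^ 2 = B := Real.sq_sqrt hB0.le
    set Q := B - ℓ with hQdef
    -- This `γ` minimizes the upper bound on `‖h - γ c g + (c/Q) p‖²` obtained from `‖g‖² ≤ R²` and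
    -- `‖p‖² ≤ ℓ`; nonnegativity of that square gives `hmain`.
    set γ := (1 + e / Q) / R ^ 2 with hγ
    have hmain : c ^ 2 - 2 * c * m ≤ Q * y := by
      have h1 := integral_sq_linear_combination hh hg hp2 1 (-(γ * c)) (c / Q)
      have h2 : 0 ≤ ∫ x, (1 * h x + -(γ * c) * g x + c / Q * p x) ^ 2 ∂μ :=
        integral_nonneg fun x => sq_nonneg _
      have h3 : ∫ x, h x * g x ∂μ = c := by simp only [hc, mul_comm]
      rw [h1, h3, ← hy, ← hm, ← he] at h2
      have h4 : (γ * c) ^ 2 * ∫ x, g x ^ 2 ∂μ ≤ (γ * c) ^ 2 * R ^ 2 := by gcongr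
      have h5 : (c / Q) ^ 2 * ∫ x, p x ^ 2 ∂μ ≤ (c / Q) ^ 2 * ℓ := by gcongr
      have h6 : 0 ≤ y + (γ * c) ^ 2 * R ^ 2 + (c / Q) ^ 2 * ℓ - 2 * γ * c ^ 2 + 2 * c / Q * m
          - 2 * γ * c * (c / Q) * e := by
        have e1 : 2 * 1 * (c / Q) * m = 2 * c / Q * m := by ring
        linarith
      have h7 : Q * (y + (γ * c) ^ 2 * R ^ 2 + (c / Q) ^ 2 * ℓ - 2 * γ * c ^ 2 + 2 * c / Q * m
          - 2 * γ * c * (c / Q) * e)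
          = Q * y + 2 * c * m - c ^ 2 * (((Q + e) ^ 2 - R ^ 2 * ℓ) / (Q * R ^ 2)) := by
        rw [hγ]; field_simp; ring
      -- Since `B = Q + ℓ`, this is `(Q + e)² ≥ R² B`, which the third alternative guarantees
      -- through `e ≥ -RL`.
      have h8 : 1 ≤ ((Q + e) ^ 2 - R ^ 2 * ℓ) / (Q * R ^ 2) := by
        rw [le_div_iff₀ (by positivity)]
        have h9 : (R * √B) ^ 2 ≤ (Q + e) ^ 2 := by gcongr; linarith
        rw [mul_pow, hBsq] at h9
        have : B = Q + ℓ := by rw [hQdef]; ring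
        rw [this] at h9
        linarith
      have h10 := mul_nonneg hQ0.le h6
      rw [h7] at h10
      have := mul_le_mul_of_nonneg_left h8 (sq_nonneg c)
      linarith
    rw [hexp]
    have h1 := hsq hh
    have h2 := mul_le_mul_of_nonneg_right hmain hN.le
    have h3 : B * y * N = ℓ * N * y + Q * y * N := by rw [hQdef]; ring
    rw [h3]
    linarith

end HasBoundedDensity

end MirrorAveraging

namespace MirrorAveraging

variable {X : Type*} [MeasurableSpace X] {μ P : Measure X}

/-! ### Calculus of exponential moments -/

lemma le_add_of_second_derivative_nonpos {ψ ψ' ψ'' : ℝ → ℝ} (h1 : ∀ t, HasDerivAt ψ (ψ' t) t)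
    (h2 : ∀ t, HasDerivAt ψ' (ψ'' t) t) (h3 : ∀ t ∈ Set.Icc (0 : ℝ) 1, ψ'' t ≤ 0) :
    ψ 1 ≤ ψ 0 + ψ' 0 := by
  have hanti : AntitoneOn ψ' (Set.Icc 0 1) := by
    refine antitoneOn_of_deriv_nonpos (convex_Icc 0 1)
      (fun t _ => (h2 t).continuousAt.continuousWithinAt)
      (fun t _ => (h2 t).differentiableAt.differentiableWithinAt) fun t ht => ?_
    rw [(h2 t).deriv]
    exact h3 t (interior_subset ht)
  have h4 : ∀ t, HasDerivAt (fun s => ψ s - ψ' 0 * s) (ψ' t - ψ' 0) t := fun t => by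
    have h := (h1 t).sub ((hasDerivAt_id t).const_mul (ψ' 0))
    rw [mul_one] at h
    exact h
  have hanti' : AntitoneOn (fun s => ψ s - ψ' 0 * s) (Set.Icc 0 1) := by
    refine antitoneOn_of_deriv_nonpos (convex_Icc 0 1)
      (fun t _ => (h4 t).continuousAt.continuousWithinAt)
      (fun t _ => (h4 t).differentiableAt.differentiableWithinAt) fun t ht => ?_
    rw [(h4 t).deriv]
    have ht' := interior_subset ht
    linarith [hanti (Set.left_mem_Icc.2 zero_le_one) ht' ht'.1]
  have := hanti' (Set.left_mem_Icc.2 zero_le_one) (Set.right_mem_Icc.2 zero_le_one) zero_le_one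
  simp only [mul_one, mul_zero, sub_zero] at this
  linarith

/-- Dominated differentiation on the unit ball around `t`, where the derivative is bounded by a
constant. Used with `u = 1` and `u = k` for the first two derivatives of the moment function. -/
lemma hasDerivAt_integral_mul_exp [IsFiniteMeasure P] {u k : X → ℝ} {A C : ℝ}
    (hu : Measurable u) (hk : Measurable k) (huA : ∀ x, |u x| ≤ A) (hkC : ∀ x, |k x| ≤ C) (t : ℝ) :
    HasDerivAt (fun s => ∫ x, u x * Real.exp (s * k x) ∂P)
      (∫ x, u x * k x * Real.exp (t * k x) ∂P) t := by
  have hexp : ∀ s x, Real.exp (s * k x) ≤ Real.exp (|s| * C) := fun s x => by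
    refine Real.exp_le_exp.2 ((le_abs_self _).trans ?_)
    rw [abs_mul]
    gcongr
    exact hkC x
  refine (hasDerivAt_integral_of_dominated_loc_of_deriv_le (s := Metric.ball t 1)
    (bound := fun _ => A * C * Real.exp ((|t| + 1) * C))
    (F := fun s x => u x * Real.exp (s * k x))
    (F' := fun s x => u x * k x * Real.exp (s * k x)) (Metric.ball_mem_nhds t one_pos)
    (.of_forall fun s => by fun_prop) ?_ (by fun_prop) ?_ (integrable_const _) ?_).2
  · refine Integrable.of_bound (by fun_prop) (A * Real.exp (|t| * C)) (.of_forall fun x => ?_)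
    rw [Real.norm_eq_abs, abs_mul, Real.abs_exp]
    have hA : 0 ≤ A := (abs_nonneg _).trans (huA x)
    exact mul_le_mul (huA x) (hexp t x) (Real.exp_pos _).le hA
  · refine .of_forall fun x s hs => ?_
    have hA : 0 ≤ A := (abs_nonneg _).trans (huA x)
    have hC : 0 ≤ C := (abs_nonneg _).trans (hkC x)
    rw [Real.norm_eq_abs, abs_mul, abs_mul, Real.abs_exp]
    have hs' : |s| ≤ |t| + 1 := by
      rw [Metric.mem_ball, Real.dist_eq] at hs
      have := abs_sub_abs_le_abs_sub s t
      linarith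
    exact mul_le_mul (mul_le_mul (huA x) (hkC x) (abs_nonneg _) hA)
      ((hexp s x).trans (Real.exp_le_exp.2 (by gcongr))) (Real.exp_pos _).le (by positivity)
  · refine .of_forall fun x s _ => ?_
    have h : HasDerivAt (fun s => u x * Real.exp (s * k x))
        (u x * (Real.exp (s * k x) * (1 * k x))) s :=
      (((hasDerivAt_id s).mul_const (k x)).exp).const_mul (u x)
    rwa [show u x * k x * Real.exp (s * k x) = u x * (Real.exp (s * k x) * (1 * k x)) by ring]

/-! ### Linear combinations of the dictionary -/

section combination

variable {M : ℕ} {φ : Fin M → X → ℝ}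

lemma combination_add {Y : Type*} (φ : Fin M → Y → ℝ) (v w : Fin M → ℝ) (x : Y) :
    combination φ (v + w) x = combination φ v x + combination φ w x := by
  simp [combination, add_mul, Finset.sum_add_distrib]

lemma combination_smul {Y : Type*} (φ : Fin M → Y → ℝ) (t : ℝ) (w : Fin M → ℝ) (x : Y) :
    combination φ (t • w) x = t * combination φ w x := by
  simp [combination, Finset.mul_sum, mul_assoc]

lemma combination_sub {Y : Type*} (φ : Fin M → Y → ℝ) (v w : Fin M → ℝ) (x : Y) :
    combination φ (v - w) x = combination φ v x - combination φ w x := by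
  simp [combination, sub_mul, Finset.sum_sub_distrib]

lemma l1Norm_nonneg (w : Fin M → ℝ) : 0 ≤ l1Norm w := Finset.sum_nonneg fun _ _ => abs_nonneg _

lemma l1Norm_add_le (v w : Fin M → ℝ) : l1Norm (v + w) ≤ l1Norm v + l1Norm w := by
  simp only [l1Norm, ← Finset.sum_add_distrib]
  exact Finset.sum_le_sum fun j _ => abs_add_le _ _

lemma l1Norm_smul (t : ℝ) (w : Fin M → ℝ) : l1Norm (t • w) = |t| * l1Norm w := by
  simp [l1Norm, Finset.mul_sum, abs_mul]

lemma l1Norm_sub_le (v w : Fin M → ℝ) : l1Norm (v - w) ≤ l1Norm v + l1Norm w := by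
  simp only [l1Norm, ← Finset.sum_add_distrib]
  exact Finset.sum_le_sum fun j _ => abs_sub _ _

lemma continuous_l1Norm : Continuous (l1Norm : (Fin M → ℝ) → ℝ) := by
  unfold l1Norm; fun_prop

lemma abs_le_l1Norm (w : Fin M → ℝ) (j : Fin M) : |w j| ≤ l1Norm w :=
  Finset.single_le_sum (f := fun j => |w j|) (fun _ _ => abs_nonneg _) (Finset.mem_univ j)

lemma l1Norm_segment_le {v w : Fin M → ℝ} {R t : ℝ} (hv : l1Norm v ≤ R) (hw : l1Norm w ≤ R)
    (ht : t ∈ Set.Icc (0 : ℝ) 1) : l1Norm (v + t • (w - v)) ≤ R := by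
  have h : v + t • (w - v) = (1 - t) • v + t • w := by
    ext j; simp; ring
  rw [h]
  refine (l1Norm_add_le _ _).trans ?_
  rw [l1Norm_smul, l1Norm_smul, abs_of_nonneg ht.1, abs_of_nonneg (sub_nonneg.2 ht.2)]
  nlinarith [ht.1, ht.2]

/-- The elements of `φ` are measurable, normalized in `L²(μ)` and bounded by `L`. -/
structure IsDictionary (μ : Measure X) (φ : Fin M → X → ℝ) (L : ℝ) : Prop where
  measurable : ∀ j, Measurable (φ j)
  memLp : ∀ j, MemLp (φ j) 2 μ
  integral_sq : ∀ j, ∫ x, φ j x ^ 2 ∂μ = 1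
  abs_apply_le : ∀ j x, |φ j x| ≤ L

lemma measurable_combination (hφ : ∀ j, Measurable (φ j)) :
    Measurable fun p : X × (Fin M → ℝ) => combination φ p.2 p.1 := by
  unfold combination
  refine Finset.measurable_sum _ fun j _ => ?_
  exact ((measurable_pi_apply j).comp measurable_snd).mul ((hφ j).comp measurable_fst)

lemma memLp_combination (hφ : ∀ j, MemLp (φ j) 2 μ) (w : Fin M → ℝ) :
    MemLp (combination φ w) 2 μ := by
  unfold combination
  exact memLp_finsetSum _ fun j _ => (hφ j).const_mul (w j)

lemma integral_mul_combination (hφ : ∀ j, MemLp (φ j) 2 μ) {g : X → ℝ} (hg : MemLp g 2 μ)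
    (w : Fin M → ℝ) :
    ∫ x, g x * combination φ w x ∂μ = ∑ j, w j * ∫ x, g x * φ j x ∂μ := by
  have h : ∀ x, g x * combination φ w x = ∑ j, w j * (g x * φ j x) := fun x => by
    simp only [combination, Finset.mul_sum]
    exact Finset.sum_congr rfl fun j _ => by ring
  simp_rw [h]
  have hi : ∀ j, Integrable (fun x => w j * (g x * φ j x)) μ := fun j =>
    (hg.integrable_mul (hφ j)).const_mul (w j)
  rw [integral_finsetSum _ fun j _ => hi j]
  simp only [integral_const_mul]

/-- The Gram form exhibits the squared norm as a polynomial in `w`; continuity, and later the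
expansion under the prior, depend on it. -/
lemma integral_sq_combination (hφ : ∀ j, MemLp (φ j) 2 μ) (w : Fin M → ℝ) :
    ∫ x, combination φ w x ^ 2 ∂μ = ∑ j, ∑ k, w j * w k * ∫ x, φ j x * φ k x ∂μ := by
  simp only [pow_two]
  rw [integral_mul_combination hφ (memLp_combination hφ w)]
  refine Finset.sum_congr rfl fun j _ => ?_
  have h : ∫ x, combination φ w x * φ j x ∂μ = ∫ x, φ j x * combination φ w x ∂μ := by
    simp only [mul_comm]
  rw [h, integral_mul_combination hφ (hφ j), Finset.mul_sum]
  simp only [mul_assoc]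

lemma continuous_integral_sq_combination (hφ : ∀ j, MemLp (φ j) 2 μ) :
    Continuous fun w => ∫ x, combination φ w x ^ 2 ∂μ := by
  simp_rw [integral_sq_combination hφ]
  fun_prop

lemma measurable_contrast (hφm : ∀ j, Measurable (φ j)) (hφ : ∀ j, MemLp (φ j) 2 μ) :
    Measurable fun p : X × (Fin M → ℝ) => contrast μ p.1 (combination φ p.2) := by
  unfold contrast
  exact ((continuous_integral_sq_combination hφ).measurable.comp measurable_snd).sub
    ((measurable_combination hφm).const_mul 2)

namespace IsDictionary

variable {L : ℝ}

lemma abs_combination_le (hφ : IsDictionary μ φ L) (w : Fin M → ℝ) (x : X) :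
    |combination φ w x| ≤ l1Norm w * L := by
  unfold combination l1Norm
  refine (Finset.abs_sum_le_sum_abs _ _).trans ?_
  rw [Finset.sum_mul]
  refine Finset.sum_le_sum fun j _ => ?_
  rw [abs_mul]
  gcongr
  exact hφ.abs_apply_le j x

lemma abs_integral_mul_le_one (hφ : IsDictionary μ φ L) (j k : Fin M) :
    |∫ x, φ j x * φ k x ∂μ| ≤ 1 := by
  have h := sq_integral_mul_le (hφ.memLp j) (hφ.memLp k)
  rw [hφ.integral_sq, hφ.integral_sq, one_mul] at h
  exact (sq_le_one_iff_abs_le_one _).1 h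

lemma integral_sq_combination_le (hφ : IsDictionary μ φ L) (w : Fin M → ℝ) :
    ∫ x, combination φ w x ^ 2 ∂μ ≤ l1Norm w ^ 2 := by
  rw [integral_sq_combination hφ.memLp, pow_two, l1Norm, Finset.sum_mul_sum]
  refine Finset.sum_le_sum fun j _ => Finset.sum_le_sum fun k _ => ?_
  refine (le_abs_self _).trans ?_
  rw [abs_mul, abs_mul]
  exact mul_le_of_le_one_right (by positivity) (hφ.abs_integral_mul_le_one j k)

lemma measurable_combination_right (hφ : IsDictionary μ φ L) (w : Fin M → ℝ) :
    Measurable (combination φ w) :=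
  (measurable_combination hφ.measurable).comp (measurable_id.prodMk measurable_const)

lemma abs_contrast_le (hφ : IsDictionary μ φ L) (hL : 0 ≤ L) {R : ℝ} {w : Fin M → ℝ}
    (hw : l1Norm w ≤ R) (x : X) : |contrast μ x (combination φ w)| ≤ R ^ 2 + 2 * R * L := by
  have h1 := hφ.integral_sq_combination_le w
  have h2 : 0 ≤ ∫ x, combination φ w x ^ 2 ∂μ := integral_nonneg fun x => sq_nonneg _
  have h3 := abs_le.1 (hφ.abs_combination_le w x)
  have h4 : l1Norm w * L ≤ R * L := by gcongr
  have h5 : l1Norm w ^ 2 ≤ R ^ 2 := pow_le_pow_left₀ (l1Norm_nonneg w) hw 2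
  unfold contrast
  rw [abs_le]
  constructor <;> nlinarith

end IsDictionary

end combination

/-! ### From the temperature condition to concavity on segments -/

/-- The condition on the temperature controls the density of the exponentially tilted measures. -/
lemma exists_weight_bound {f : X → ℝ} {L R β : ℝ} (hP : HasBoundedDensity μ P f L) (hL : 0 < L)
    (hR : 0 < R) (hβ : 2 * L + 4 * R * L ≤
      (β - 2 * R ^ 2) * Real.exp (-(4 * R * (L + √L)) / β)) (hβ0 : 0 < β)
    {u : X → ℝ} (hum : Measurable u) (hu : MemLp u 2 μ) (huR : ∫ x, u x ^ 2 ∂μ ≤ (2 * R) ^ 2)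
    (hub : ∀ x, |u x| ≤ 2 * R * L) :
    ∃ ℓ : ℝ, 0 < ℓ ∧
      (∀ x, L * Real.exp (2 / β * u x) ≤ ℓ * ∫ y, Real.exp (2 / β * u y) ∂P) ∧
      ((√ℓ + R) ^ 2 ≤ β / 2 ∨ (R + L) ^ 2 + ℓ ≤ β / 2 ∨ ℓ + R * L + R * √(β / 2) ≤ β / 2) := by
  have := hP.isProbabilityMeasure
  have hexpb : ∀ x, Real.exp (2 / β * u x) ≤ Real.exp (4 * R * L / β) := fun x => by
    refine Real.exp_le_exp.2 ?_
    rw [show 4 * R * L / β = 2 / β * (2 * R * L) by ring]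
    gcongr
    exact (le_abs_self _).trans (hub x)
  have hexpi : Integrable (fun x => Real.exp (2 / β * u x)) P := by
    refine Integrable.of_bound (by fun_prop) (Real.exp (4 * R * L / β)) (.of_forall fun x => ?_)
    rw [Real.norm_eq_abs, Real.abs_exp]
    exact hexpb x
  have hβ' : R ^ 2 + (L + 2 * R * L) * Real.exp (2 * R * (L + √L) / (β / 2)) ≤ β / 2 := by
    have h1 : 2 * R * (L + √L) / (β / 2) = 4 * R * (L + √L) / β := by field_simp; ring
    rw [h1]
    rw [neg_div, Real.exp_neg, ← div_eq_mul_inv, le_div_iff₀ (Real.exp_pos _)] at hβ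
    linarith
  have hsqrt : √L ^ 2 = L := Real.sq_sqrt hL.le
  -- The normalizer `∫ ω dP` has two lower bounds, with exponents `4RL/β` (pointwise) and `4R√L/β`
  -- (Jensen); the smaller exponent is taken on each side of `L = 1`.
  rcases lt_or_ge L 1 with hL1 | hL1
  · have hlow : Real.exp (-(4 * R * L / β)) ≤ ∫ y, Real.exp (2 / β * u y) ∂P := by
      have h := integral_mono (integrable_const (Real.exp (-(4 * R * L / β)))) hexpi fun x => by
        refine Real.exp_le_exp.2 ?_
        rw [show -(4 * R * L / β) = 2 / β * (-(2 * R * L)) by ring]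
        gcongr
        exact neg_le_of_abs_le (hub x)
      simpa using h
    refine ⟨L * Real.exp (4 * R * L / (β / 2)), by positivity, fun x => ?_, .inr ?_⟩
    · rw [mul_assoc]
      gcongr
      refine (hexpb x).trans ?_
      have h1 : Real.exp (4 * R * L / β)
          = Real.exp (4 * R * L / (β / 2)) * Real.exp (-(4 * R * L / β)) := by
        rw [← Real.exp_add]; congr 1; field_simp; ring
      rw [h1]
      gcongr
    · exact temperature_alternatives hL hL1 hR hβ'
  · have hlow : Real.exp (-(4 * R * √L / β)) ≤ ∫ y, Real.exp (2 / β * u y) ∂P := by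
      have h1 : Real.exp (∫ x, 2 / β * u x ∂P) ≤ ∫ y, Real.exp (2 / β * u y) ∂P :=
        convexOn_exp.map_integral_le Real.continuous_exp.continuousOn isClosed_univ (by simp)
          (((hP.memLp_two hu).integrable one_le_two).const_mul _) hexpi
      refine le_trans (Real.exp_le_exp.2 ?_) h1
      rw [integral_const_mul, show -(4 * R * √L / β) = 2 / β * (-(2 * R * √L)) by ring]
      gcongr
      refine neg_le_of_abs_le (abs_le_of_sq_le_sq ?_ (by positivity))
      refine (hP.sq_integral_le hL.le hu).trans ?_
      rw [mul_pow, hsqrt, mul_comm L]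
      gcongr
    refine ⟨L * Real.exp (4 * R * (L + √L) / β), by positivity, fun x => ?_, .inl ?_⟩
    · rw [mul_assoc]
      gcongr
      refine (hexpb x).trans ?_
      have h1 : Real.exp (4 * R * L / β)
          = Real.exp (4 * R * (L + √L) / β) * Real.exp (-(4 * R * √L / β)) := by
        rw [← Real.exp_add]; congr 1; ring
      rw [h1]
      gcongr
    · have h1 : 2 * R * (L + √L) / (β / 2) = 4 * R * (L + √L) / β := by field_simp; ring
      rw [h1] at hβ'
      have hK : 1 ≤ Real.exp (4 * R * (L + √L) / β) := Real.one_le_exp (by positivity)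
      set ℓ := L * Real.exp (4 * R * (L + √L) / β) with hℓ
      have hℓ1 : 1 ≤ ℓ := one_le_mul_of_one_le_of_one_le hL1 hK
      have hq : √ℓ ^ 2 = ℓ := Real.sq_sqrt (by linarith)
      -- Here `L ≥ 1` enters: `√ℓ ≤ ℓ` gives `(√ℓ + R)² ≤ R² + ℓ + 2Rℓ`, the left side of `hβ'`.
      have hqℓ : √ℓ ≤ ℓ := by
        rw [Real.sqrt_le_left (by linarith)]; nlinarith
      have h2 := mul_le_mul_of_nonneg_left hqℓ hR.le
      nlinarith

section one_step

variable {M : ℕ} {φ : Fin M → X → ℝ} {f : X → ℝ} {L R β : ℝ}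

lemma integral_sq_combination_segment (hφ : ∀ j, MemLp (φ j) 2 μ) (v u : Fin M → ℝ) (t : ℝ) :
    ∫ x, combination φ (v + t • u) x ^ 2 ∂μ = (∫ x, combination φ v x ^ 2 ∂μ)
      + 2 * t * (∫ x, combination φ v x * combination φ u x ∂μ)
      + t ^ 2 * ∫ x, combination φ u x ^ 2 ∂μ := by
  have h := integral_sq_linear_combination (memLp_combination hφ v) (memLp_combination hφ u)
    (memLp_combination hφ u) 1 t 0
  have h1 : ∀ x, combination φ (v + t • u) x
      = 1 * combination φ v x + t * combination φ u x + 0 * combination φ u x := fun x => by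
    rw [combination_add, combination_smul]; ring
  simp_rw [h1]
  rw [h]
  ring

/-- The exponential moments of the contrast lie below their tangent at `v`. -/
lemma integral_exp_contrast_sub_le (hφ : IsDictionary μ φ L) (hP : HasBoundedDensity μ P f L)
    (hL : 0 < L) (hR : 0 < R) (hβ0 : 0 < β) (hβ : 2 * L + 4 * R * L ≤
      (β - 2 * R ^ 2) * Real.exp (-(4 * R * (L + √L)) / β))
    {v w : Fin M → ℝ} (hv : l1Norm v ≤ R) (hw : l1Norm w ≤ R) :
    ∫ x, Real.exp (1 / β * contrast μ x (combination φ v)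
        - 1 / β * contrast μ x (combination φ w)) ∂P ≤
      1 + 2 / β * ((∫ x, combination φ (w - v) x ∂P)
        - ∫ x, combination φ v x * combination φ (w - v) x ∂μ) := by
  have := hP.isProbabilityMeasure
  set h := combination φ (w - v) with hh
  have hhm : Measurable h := hφ.measurable_combination_right _
  have hh2 : MemLp h 2 μ := memLp_combination hφ.memLp _
  have hl1 : l1Norm (w - v) ≤ 2 * R := (l1Norm_sub_le _ _).trans (by linarith)
  have hhb : ∀ x, |h x| ≤ 2 * R * L := fun x =>
    (hφ.abs_combination_le _ x).trans (by gcongr)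
  set k : X → ℝ := fun x => 2 / β * h x with hk
  have hkm : Measurable k := hhm.const_mul _
  have hkC : ∀ x, |k x| ≤ 2 / β * (2 * R * L) := fun x => by
    simp only [hk]
    rw [abs_mul, abs_of_pos (by positivity)]
    gcongr
    exact hhb x
  set c := ∫ x, combination φ v x * h x ∂μ with hc
  set y := ∫ x, h x ^ 2 ∂μ with hy
  -- Along `v + t(w - v)`, `(Q(x, f_v) - Q(x, ·))/β` equals `s t + t * k x`: a deterministic
  -- quadratic plus a linear random part. So the expectation factors as `exp (s t) * H t`.
  set s : ℝ → ℝ := fun t => -(1 / β) * (2 * t * c + t ^ 2 * y) with hs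
  set s' : ℝ → ℝ := fun t => -(2 / β) * (c + t * y) with hs'
  have hds : ∀ t, HasDerivAt s (s' t) t := fun t => by
    have h1 : HasDerivAt s (-(1 / β) * (2 * 1 * c + ((2 : ℕ) * t ^ (2 - 1)) * y)) t :=
      (((((hasDerivAt_id t).const_mul 2).mul_const c)).add
        ((hasDerivAt_pow 2 t).mul_const y)).const_mul _
    convert h1 using 1
    simp only [hs']; push_cast; ring
  have hds' : ∀ t, HasDerivAt s' (-(2 / β) * y) t := fun t => by
    have h1 : HasDerivAt s' (-(2 / β) * (1 * y)) t :=
      (((hasDerivAt_id t).mul_const y).const_add c).const_mul _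
    rwa [one_mul] at h1
  set H : ℝ → ℝ := fun t => ∫ x, Real.exp (t * k x) ∂P with hH
  set H' : ℝ → ℝ := fun t => ∫ x, k x * Real.exp (t * k x) ∂P with hH'
  set H'' : ℝ → ℝ := fun t => ∫ x, k x * k x * Real.exp (t * k x) ∂P with hH''
  have hdH : ∀ t, HasDerivAt H (H' t) t := fun t => by
    have h1 := hasDerivAt_integral_mul_exp (P := P) (u := fun _ => 1) (A := 1) measurable_const
      hkm (by simp) hkC t
    simpa only [one_mul] using h1
  have hdH' : ∀ t, HasDerivAt H' (H'' t) t := fun t =>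
    hasDerivAt_integral_mul_exp hkm hkm hkC hkC t
  have hψ : ∀ t, HasDerivAt (fun t => Real.exp (s t) * H t)
      (Real.exp (s t) * (s' t * H t + H' t)) t := fun t => by
    refine ((hds t).exp.mul (hdH t)).congr_deriv ?_
    ring
  have hψ' : ∀ t, HasDerivAt (fun t => Real.exp (s t) * (s' t * H t + H' t))
      (Real.exp (s t) * (s' t ^ 2 * H t + 2 * s' t * H' t + H'' t - 2 / β * y * H t)) t :=
    fun t => by
    refine ((hds t).exp.mul (((hds' t).mul (hdH t)).add (hdH' t))).congr_deriv ?_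
    simp only [Pi.add_apply, Pi.mul_apply]
    ring
  have hnonpos : ∀ t ∈ Set.Icc (0 : ℝ) 1,
      Real.exp (s t) * (s' t ^ 2 * H t + 2 * s' t * H' t + H'' t - 2 / β * y * H t) ≤ 0 := by
    intro t ht
    refine mul_nonpos_of_nonneg_of_nonpos (Real.exp_pos _).le ?_
    set g := combination φ (v + t • (w - v)) with hg
    have hgl1 := l1Norm_segment_le hv hw ht
    have hg2 : MemLp g 2 μ := memLp_combination hφ.memLp _
    have hgR : ∫ x, g x ^ 2 ∂μ ≤ R ^ 2 := (hφ.integral_sq_combination_le _).trans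
      (pow_le_pow_left₀ (l1Norm_nonneg _) hgl1 2)
    have hgb : ∀ x, |g x| ≤ R * L := fun x => (hφ.abs_combination_le _ x).trans (by gcongr)
    have hgh : ∫ x, g x * h x ∂μ = c + t * y := by
      have h1 : ∀ x, g x * h x = combination φ v x * h x + t * h x ^ 2 := fun x => by
        rw [hg, combination_add, combination_smul, ← hh]; ring
      simp_rw [h1]
      have i1 : Integrable (fun x => combination φ v x * h x) μ :=
        (memLp_combination hφ.memLp v).integrable_mul hh2
      rw [integral_add i1 (hh2.integrable_sq.const_mul t), integral_const_mul]
    have ht1 : |t| ≤ 1 := by rw [abs_of_nonneg ht.1]; exact ht.2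
    -- The tilt at time `t` is `exp((2/β) t h)`, whence the bound for `u = t h`; `|t| ≤ 1` keeps its
    -- norms below those of `h`.
    obtain ⟨ℓ, hℓ, hωℓ, hB⟩ := exists_weight_bound (u := fun x => t * h x) hP hL hR hβ hβ0
      (hhm.const_mul t) (hh2.const_mul t) (by
        simp only [mul_pow]
        rw [integral_const_mul]
        have h1 : y ≤ (2 * R) ^ 2 := (hφ.integral_sq_combination_le _).trans
          (pow_le_pow_left₀ (l1Norm_nonneg _) hl1 2)
        have h2 : t ^ 2 ≤ 1 := (sq_le_one_iff_abs_le_one t).2 ht1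
        have h3 : 0 ≤ y := integral_nonneg fun x => sq_nonneg _
        nlinarith) (fun x => by
        rw [abs_mul]
        exact (mul_le_of_le_one_left (abs_nonneg _) ht1).trans (hhb x))
    have hω : ∀ x, Real.exp (2 / β * (t * h x)) = Real.exp (t * k x) := fun x => by
      congr 1; simp only [hk]; ring
    simp_rw [hω] at hωℓ
    have hωC : ∀ x, Real.exp (t * k x) ≤ Real.exp (2 / β * (2 * R * L)) := fun x => by
      refine Real.exp_le_exp.2 ((le_abs_self _).trans ?_)
      rw [abs_mul]
      exact (mul_le_of_le_one_left (abs_nonneg _) ht1).trans (hkC x)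
    have hωm : Measurable fun x => Real.exp (t * k x) := by fun_prop
    have hvar := hP.weighted_variance_le hL hℓ hωm (fun x => Real.exp_pos _) hωC hωℓ hg2 hh2 hR
      hgR hgb hB
    rw [hgh, ← hy] at hvar
    -- The centering constant is `⟨g, h⟩ = c + t y`, so the second derivative is a multiple of a
    -- weighted variance minus `(2/β) y H`; the variance bound is used with `B = β/2`.
    have hexp : (2 / β) ^ 2 * ∫ x, (h x - (c + t * y)) ^ 2 * Real.exp (t * k x) ∂P
        = s' t ^ 2 * H t + 2 * s' t * H' t + H'' t := by
      have hbi : ∀ {u : X → ℝ}, Integrable u P →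
          Integrable (fun x => u x * Real.exp (t * k x)) P := fun hu =>
        HasBoundedDensity.integrable_mul_weight hωm (fun x => Real.exp_pos _) hωC hu
      have i0 : Integrable (fun x => Real.exp (t * k x)) P :=
        hP.integrable_weight hωm (fun x => Real.exp_pos _) hωC
      have hk2 : MemLp k 2 P := (hP.memLp_two hh2).const_mul _
      have i1 : Integrable (fun x => k x * Real.exp (t * k x)) P := hbi (hk2.integrable one_le_two)
      have i2 : Integrable (fun x => k x * k x * Real.exp (t * k x)) P :=
        hbi (hk2.integrable_mul hk2)
      have h1 : ∀ x, (2 / β) ^ 2 * ((h x - (c + t * y)) ^ 2 * Real.exp (t * k x))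
          = s' t ^ 2 * Real.exp (t * k x) + 2 * s' t * (k x * Real.exp (t * k x))
            + k x * k x * Real.exp (t * k x) := fun x => by
        simp only [hs', hk]; ring
      rw [← integral_const_mul, integral_congr_ae (.of_forall h1),
        integral_add (by fun_prop) (by fun_prop), integral_add (by fun_prop) (by fun_prop),
        integral_const_mul, integral_const_mul]
    have h1 := mul_le_mul_of_nonneg_left hvar (sq_nonneg (2 / β))
    rw [hexp] at h1
    have h2 : (2 / β) ^ 2 * (β / 2 * y * ∫ x, Real.exp (t * k x) ∂P) = 2 / β * y * H t := by
      simp only [hH]; field_simp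
    linarith
  have hfinal := le_add_of_second_derivative_nonpos hψ hψ' hnonpos
  have hH0 : H 0 = 1 := by simp [hH]
  have hH'0 : H' 0 = 2 / β * ∫ x, h x ∂P := by
    simp only [hH', zero_mul, Real.exp_zero, mul_one, hk, integral_const_mul]
  have hs0 : s 0 = 0 := by simp [hs]
  have hs'0 : s' 0 = -(2 / β) * c := by simp [hs']
  rw [hH0, hH'0, hs0, hs'0, Real.exp_zero] at hfinal
  have hleft : ∫ x, Real.exp (1 / β * contrast μ x (combination φ v)
        - 1 / β * contrast μ x (combination φ w)) ∂P = Real.exp (s 1) * H 1 := by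
    simp only [hH]
    rw [← integral_const_mul]
    congr 1 with x
    rw [← Real.exp_add]
    congr 1
    have h1 := integral_sq_combination_segment hφ.memLp v (w - v) 1
    have h2 : v + (1 : ℝ) • (w - v) = w := by simp
    rw [h2] at h1
    simp only [contrast, hs, hk]
    rw [h1, hh, combination_sub]
    ring
  rw [hleft]
  refine hfinal.trans (le_of_eq ?_)
  ring

end one_step

end MirrorAveraging

/-! ### One progressive mixture step -/

namespace MirrorAveraging

variable {X : Type*} [MeasurableSpace X] {μ P : Measure X}
variable {M : ℕ} {φ : Fin M → X → ℝ} {f : X → ℝ} {L R β : ℝ}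

/-- The mean of a measure on `ℝ^M`. -/
noncomputable def meanVector (θ : Measure (Fin M → ℝ)) : Fin M → ℝ := fun j => ∫ w, w j ∂θ

lemma integrable_apply {θ : Measure (Fin M → ℝ)} [IsFiniteMeasure θ]
    (hθ : ∀ᵐ w ∂θ, l1Norm w ≤ R) (j : Fin M) : Integrable (fun w : Fin M → ℝ => w j) θ := by
  refine Integrable.of_bound (measurable_pi_apply j).aestronglyMeasurable R ?_
  filter_upwards [hθ] with w hw using (abs_le_l1Norm w j).trans hw

lemma l1Norm_meanVector_le {θ : Measure (Fin M → ℝ)} [IsProbabilityMeasure θ]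
    (hθ : ∀ᵐ w ∂θ, l1Norm w ≤ R) : l1Norm (meanVector θ) ≤ R := by
  have hi := integrable_apply hθ
  calc l1Norm (meanVector θ) ≤ ∑ j, ∫ w, |w j| ∂θ :=
        Finset.sum_le_sum fun j _ => abs_integral_le_integral_abs
    _ = ∫ w, l1Norm w ∂θ := (integral_finsetSum _ fun j _ => (hi j).abs).symm
    _ ≤ ∫ _, R ∂θ :=
        integral_mono_ae (integrable_finsetSum _ fun j _ => (hi j).abs) (integrable_const R) hθ
    _ = R := by simp

lemma integral_linear_sub_meanVector {θ : Measure (Fin M → ℝ)} [IsProbabilityMeasure θ]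
    (hθ : ∀ᵐ w ∂θ, l1Norm w ≤ R) (d : Fin M → ℝ) :
    ∫ w, ∑ j, (w - meanVector θ) j * d j ∂θ = 0 := by
  have hi := integrable_apply hθ
  have h : ∀ j, ∫ w, (w - meanVector θ) j * d j ∂θ = 0 := fun j => by
    rw [integral_mul_const]
    simp only [Pi.sub_apply]
    rw [integral_sub (hi j) (integrable_const _), integral_const]
    simp [meanVector]
  rw [integral_finsetSum]
  · simp only [h, Finset.sum_const_zero]
  · exact fun j _ => ((hi j).sub (integrable_const _)).mul_const _

namespace IsDictionary

lemma measurable_exp_contrast (hφ : IsDictionary μ φ L) (b : ℝ) :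
    Measurable fun p : X × (Fin M → ℝ) => Real.exp (b * contrast μ p.1 (combination φ p.2)) :=
  ((measurable_contrast hφ.measurable hφ.memLp).const_mul b).exp

lemma measurable_integral_exp_contrast (hφ : IsDictionary μ φ L) (b : ℝ)
    (θ : Measure (Fin M → ℝ)) [SFinite θ] :
    Measurable fun x => ∫ w, Real.exp (b * contrast μ x (combination φ w)) ∂θ :=
  ((hφ.measurable_exp_contrast b).stronglyMeasurable.integral_prod_right (f := fun x w =>
    Real.exp (b * contrast μ x (combination φ w)))).measurable

set_option maxHeartbeats 1000000 in
/-- One step of the progressive mixture argument: the risk of the mean of a probability measure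
`θ` is at most its mixability loss. -/
lemma integral_contrast_meanVector_le (hφ : IsDictionary μ φ L)
    (hP : HasBoundedDensity μ P f L) (hL : 0 < L) (hR : 0 < R) (hβ0 : 0 < β)
    (hβ : 2 * L + 4 * R * L ≤ (β - 2 * R ^ 2) * Real.exp (-(4 * R * (L + √L)) / β))
    {θ : Measure (Fin M → ℝ)} [IsProbabilityMeasure θ] (hθ : ∀ᵐ w ∂θ, l1Norm w ≤ R) :
    ∫ x, contrast μ x (combination φ (meanVector θ)) ∂P ≤
      -β * ∫ x, Real.log (∫ w, Real.exp (-(1 / β) * contrast μ x (combination φ w)) ∂θ) ∂P := by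
  have := hP.isProbabilityMeasure
  set v := meanVector θ with hv
  have hvR : l1Norm v ≤ R := l1Norm_meanVector_le hθ
  set q : X → (Fin M → ℝ) → ℝ := fun x w => contrast μ x (combination φ w) with hq
  set c := R ^ 2 + 2 * R * L with hc
  have hqc : ∀ x w, l1Norm w ≤ R → |q x w| ≤ c := fun x w hw => hφ.abs_contrast_le hL.le hw x
  have hqm : Measurable fun p : X × (Fin M → ℝ) => q p.1 p.2 :=
    measurable_contrast hφ.measurable hφ.memLp
  have hqvm : Measurable fun x => q x v := hqm.comp (measurable_id.prodMk measurable_const)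
  have hqvi : Integrable (fun x => q x v) P :=
    Integrable.of_bound hqvm.aestronglyMeasurable c (.of_forall fun x => hqc x v hvR)
  set I : X → ℝ := fun x => ∫ w, Real.exp (-(1 / β) * q x w) ∂θ with hI
  have hIm : Measurable I := hφ.measurable_integral_exp_contrast _ θ
  have hexpb : ∀ x w, l1Norm w ≤ R → Real.exp (-(1 / β) * q x w) ∈
      Set.Icc (Real.exp (-(1 / β * c))) (Real.exp (1 / β * c)) := fun x w hw => by
    have h1 := abs_le.1 (hqc x w hw)
    have h2 : 0 < 1 / β := by positivity
    constructor <;> refine Real.exp_le_exp.2 ?_ <;> nlinarith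
  have hexpi : ∀ x, Integrable (fun w => Real.exp (-(1 / β) * q x w)) θ := fun x => by
    refine Integrable.of_bound ((hφ.measurable_exp_contrast _).comp
      (measurable_const.prodMk measurable_id)).aestronglyMeasurable (Real.exp (1 / β * c)) ?_
    filter_upwards [hθ] with w hw
    rw [Real.norm_eq_abs, Real.abs_exp]
    exact (hexpb x w hw).2
  have hIlow : ∀ x, Real.exp (-(1 / β * c)) ≤ I x := fun x => by
    have h := integral_mono_ae (integrable_const (Real.exp (-(1 / β * c)))) (hexpi x)
      (hθ.mono fun w hw => (hexpb x w hw).1)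
    simpa only [integral_const, probReal_univ, one_smul] using h
  have hIup : ∀ x, I x ≤ Real.exp (1 / β * c) := fun x => by
    have h := integral_mono_ae (hexpi x) (integrable_const (Real.exp (1 / β * c)))
      (hθ.mono fun w hw => (hexpb x w hw).2)
    simpa only [integral_const, probReal_univ, one_smul] using h
  have hI0 : ∀ x, 0 < I x := fun x => (Real.exp_pos _).trans_le (hIlow x)
  have hlogi : Integrable (fun x => Real.log (I x)) P := by
    refine Integrable.of_bound hIm.log.aestronglyMeasurable (1 / β * c) (.of_forall fun x => ?_)
    rw [Real.norm_eq_abs, abs_le]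
    exact ⟨(Real.le_log_iff_exp_le (hI0 x)).2 (hIlow x),
      (Real.log_le_iff_le_exp (hI0 x)).2 (hIup x)⟩
  set F : X × (Fin M → ℝ) → ℝ := fun p => Real.exp (1 / β * q p.1 v - 1 / β * q p.1 p.2) with hF
  have hFm : Measurable F :=
    (((hqvm.comp measurable_fst).const_mul _).sub (hqm.const_mul _)).exp
  have hFi : Integrable F (P.prod θ) := by
    refine Integrable.of_bound hFm.aestronglyMeasurable (Real.exp (1 / β * c + 1 / β * c)) ?_
    have h1 : ∀ᵐ p ∂(P.prod θ), l1Norm p.2 ≤ R := Measure.quasiMeasurePreserving_snd.ae hθ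
    filter_upwards [h1] with p hp
    rw [Real.norm_eq_abs, Real.abs_exp]
    refine Real.exp_le_exp.2 ?_
    have h2 := abs_le.1 (hqc p.1 v hvR)
    have h3 := abs_le.1 (hqc p.1 p.2 hp)
    have h4 : 0 < 1 / β := by positivity
    nlinarith
  set Y : X → ℝ := fun x => ∫ w, F (x, w) ∂θ with hY
  have hYI : ∀ x, Y x = Real.exp (1 / β * q x v) * I x := fun x => by
    simp only [hY, hI, hF]
    rw [← integral_const_mul]
    congr 1 with w
    rw [← Real.exp_add]
    congr 1
    ring
  have hYi : Integrable Y P := hFi.integral_prod_left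
  -- `log Y ≤ Y - 1` replaces the logarithm by an expectation that Fubini can exchange with `θ`.
  have hlog : ∀ x, 1 / β * q x v + Real.log (I x) ≤ Y x - 1 := fun x => by
    have h1 : Real.log (Y x) = 1 / β * q x v + Real.log (I x) := by
      rw [hYI, Real.log_mul (Real.exp_ne_zero _) (hI0 x).ne', Real.log_exp]
    rw [← h1]
    refine Real.log_le_sub_one_of_pos ?_
    rw [hYI]
    exact mul_pos (Real.exp_pos _) (hI0 x)
  -- The slope of the tangent at `v`, up to `2/β`; the linear term averages to zero because `v` is
  -- the mean of `θ`.
  set d : Fin M → ℝ := fun j => (∫ x, φ j x ∂P) - ∫ x, combination φ v x * φ j x ∂μ with hd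
  have hYle : ∫ x, Y x ∂P ≤ 1 := by
    have h1 : ∫ x, Y x ∂P = ∫ w, ∫ x, F (x, w) ∂P ∂θ := integral_integral_swap hFi
    rw [h1]
    have hdi : Integrable (fun w => ∑ j, (w - v) j * d j) θ := integrable_finsetSum _ fun j _ =>
      ((integrable_apply hθ j).sub (integrable_const _)).mul_const _
    have h2 : ∫ w, ∫ x, F (x, w) ∂P ∂θ ≤ ∫ w, (1 + 2 / β * ∑ j, (w - v) j * d j) ∂θ := by
      refine integral_mono_ae hFi.integral_prod_right
        ((integrable_const _).add (hdi.const_mul _)) ?_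
      filter_upwards [hθ] with w hw
      have h3 := integral_exp_contrast_sub_le hφ hP hL hR hβ0 hβ hvR hw
      refine h3.trans (le_of_eq ?_)
      have h4 := integral_mul_combination hφ.memLp (memLp_combination hφ.memLp v) (w - v)
      have h5 := integral_mul_combination (μ := P) (fun j => hP.memLp_two (hφ.memLp j))
        (memLp_const (1 : ℝ)) (w - v)
      simp only [one_mul] at h5
      rw [h4, h5, ← Finset.sum_sub_distrib]
      congr 2
      exact Finset.sum_congr rfl fun j _ => by simp only [hd]; ring
    rw [integral_add (integrable_const _) (hdi.const_mul _), integral_const_mul,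
      integral_linear_sub_meanVector hθ] at h2
    simpa using h2
  have hsum : 1 / β * (∫ x, q x v ∂P) + ∫ x, Real.log (I x) ∂P ≤ 0 := by
    have h1 := integral_mono ((hqvi.const_mul (1 / β)).add hlogi) (hYi.sub (integrable_const 1))
      hlog
    simp only [Pi.add_apply, Pi.sub_apply] at h1
    rw [integral_add (hqvi.const_mul (1 / β)) hlogi, integral_const_mul,
      integral_sub hYi (integrable_const 1)] at h1
    simp only [integral_const, probReal_univ, smul_eq_mul, mul_one] at h1
    linarith
  have h1 := mul_le_mul_of_nonneg_left hsum hβ0.le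
  have h2 : β * (1 / β * (∫ x, q x v ∂P) + ∫ x, Real.log (I x) ∂P)
      = (∫ x, q x v ∂P) + β * ∫ x, Real.log (I x) ∂P := by field_simp
  linarith

end IsDictionary

end MirrorAveraging

/-! ### The sparsity prior: moments and concentration -/

namespace MirrorAveraging

section univariate

variable {τ : ℝ}

lemma integrable_inv_sq_add_sq (hτ : 0 < τ) : Integrable fun t : ℝ => (τ ^ 2 + t ^ 2)⁻¹ := by
  have hm : 0 < min (τ ^ 2) 1 := lt_min (by positivity) one_pos
  refine (integrable_inv_one_add_sq.const_mul (min (τ ^ 2) 1)⁻¹).mono'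
    (by fun_prop) (.of_forall fun t => ?_)
  rw [Real.norm_of_nonneg (by positivity), ← mul_inv]
  refine inv_anti₀ (by positivity) ?_
  rw [mul_add, mul_one]
  exact add_le_add (min_le_left _ _) (mul_le_of_le_one_left (sq_nonneg t) (min_le_right _ _))

lemma integrable_priorFactor (hτ : 0 < τ) : Integrable fun t : ℝ => ((τ ^ 2 + t ^ 2) ^ 2)⁻¹ := by
  refine ((integrable_inv_sq_add_sq hτ).const_mul (τ ^ 2)⁻¹).mono' (by fun_prop)
    (.of_forall fun t => ?_)
  rw [Real.norm_of_nonneg (by positivity), ← mul_inv]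
  refine inv_anti₀ (by positivity) ?_
  rw [pow_two (τ ^ 2 + t ^ 2)]
  gcongr
  linarith [sq_nonneg t]

lemma integrable_sq_mul_priorFactor (hτ : 0 < τ) :
    Integrable fun t : ℝ => t ^ 2 * ((τ ^ 2 + t ^ 2) ^ 2)⁻¹ := by
  refine (integrable_inv_sq_add_sq hτ).mono' (by fun_prop) (.of_forall fun t => ?_)
  rw [Real.norm_of_nonneg (by positivity), ← div_eq_mul_inv, div_le_iff₀ (by positivity)]
  have : (τ ^ 2 + t ^ 2)⁻¹ * (τ ^ 2 + t ^ 2) ^ 2 = τ ^ 2 + t ^ 2 := by field_simp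
  rw [this]
  linarith [sq_nonneg τ]

/-- The difference of the integrands is the derivative of `-t/(τ² + t²)`, which vanishes at both
infinities. -/
lemma integral_sq_mul_priorFactor (hτ : 0 < τ) :
    ∫ t : ℝ, t ^ 2 * ((τ ^ 2 + t ^ 2) ^ 2)⁻¹ = τ ^ 2 * ∫ t : ℝ, ((τ ^ 2 + t ^ 2) ^ 2)⁻¹ := by
  have hi := (integrable_sq_mul_priorFactor hτ).sub ((integrable_priorFactor hτ).const_mul (τ ^ 2))
  have hd : ∀ t : ℝ, HasDerivAt (fun t => -(t / (τ ^ 2 + t ^ 2)))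
      (t ^ 2 * ((τ ^ 2 + t ^ 2) ^ 2)⁻¹ - τ ^ 2 * ((τ ^ 2 + t ^ 2) ^ 2)⁻¹) t := fun t => by
    have hne : τ ^ 2 + t ^ 2 ≠ 0 := by positivity
    refine ((hasDerivAt_id t).div ((hasDerivAt_pow 2 t).const_add (τ ^ 2)) hne).neg.congr_deriv ?_
    simp only [id_eq]
    field_simp
    push_cast
    ring
  have hb : ∀ t : ℝ, ‖-(t / (τ ^ 2 + t ^ 2))‖ ≤ ‖t‖⁻¹ := fun t => by
    rw [norm_neg, norm_div, Real.norm_of_nonneg (by positivity : 0 ≤ τ ^ 2 + t ^ 2)]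
    rcases eq_or_ne t 0 with rfl | ht
    · simp
    · have : 0 < ‖t‖ := norm_pos_iff.2 ht
      rw [div_le_iff₀ (by positivity), le_inv_mul_iff₀ this, ← pow_two, Real.norm_eq_abs, sq_abs]
      linarith [sq_nonneg τ]
  have h := integral_of_hasDerivAt_of_tendsto hd hi
    (squeeze_zero_norm hb (tendsto_inv_atTop_zero.comp Filter.tendsto_abs_atBot_atTop))
    (squeeze_zero_norm hb (tendsto_inv_atTop_zero.comp tendsto_norm_atTop_atTop))
  rw [integral_sub (integrable_sq_mul_priorFactor hτ) ((integrable_priorFactor hτ).const_mul _),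
    integral_const_mul, sub_self] at h
  linarith

end univariate

variable {M : ℕ} {τ r R : ℝ}

/-- The unrestricted density of the sparsity prior, up to normalization. -/
noncomputable def priorWeight (τ : ℝ) (w : Fin M → ℝ) : ℝ := ∏ j, ((τ ^ 2 + w j ^ 2) ^ 2)⁻¹

lemma priorWeight_pos (hτ : 0 < τ) (w : Fin M → ℝ) : 0 < priorWeight τ w :=
  Finset.prod_pos fun j _ => by positivity

lemma measurable_priorWeight : Measurable (priorWeight τ : (Fin M → ℝ) → ℝ) := by
  unfold priorWeight; fun_prop

lemma measurableSet_ball (r : ℝ) : MeasurableSet {w : Fin M → ℝ | l1Norm w ≤ r} :=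
  measurableSet_le continuous_l1Norm.measurable measurable_const

lemma unnormalizedPrior_eq (M : ℕ) (τ r : ℝ) :
    unnormalizedPrior M τ r = (volume : Measure (Fin M → ℝ)).withDensity
      ({w | l1Norm w ≤ r}.indicator fun w => ENNReal.ofReal (priorWeight τ w)) :=
  (withDensity_indicator (measurableSet_ball r) _).symm

lemma integrable_priorWeight (hτ : 0 < τ) :
    Integrable (priorWeight τ : (Fin M → ℝ) → ℝ) :=
  Integrable.fintype_prod (f := fun (_ : Fin M) t => ((τ ^ 2 + t ^ 2) ^ 2)⁻¹)
    fun _ => integrable_priorFactor hτ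

/-- The integrand is still a product of one-variable functions, with the extra `t²` in the `j`-th
factor only. -/
lemma integrable_and_integral_sq_mul_priorWeight (hτ : 0 < τ) (j : Fin M) :
    Integrable (fun w : Fin M → ℝ => w j ^ 2 * priorWeight τ w) ∧
      ∫ w : Fin M → ℝ, w j ^ 2 * priorWeight τ w = τ ^ 2 * ∫ w : Fin M → ℝ, priorWeight τ w := by
  set F : Fin M → ℝ → ℝ := fun i t => (if i = j then t ^ 2 else 1) * ((τ ^ 2 + t ^ 2) ^ 2)⁻¹
    with hF
  have hprod : ∀ w : Fin M → ℝ, ∏ i, F i (w i) = w j ^ 2 * priorWeight τ w := fun w => by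
    simp only [hF, Finset.prod_mul_distrib, Finset.prod_ite_eq', Finset.mem_univ, if_true,
      priorWeight]
  have hint : ∀ i, Integrable (F i) := fun i => by
    by_cases hij : i = j
    · simpa only [hF, hij, if_true] using integrable_sq_mul_priorFactor hτ
    · simpa only [hF, hij, if_false, one_mul] using integrable_priorFactor hτ
  have hval : ∀ i, ∫ t, F i t = (if i = j then τ ^ 2 else 1) * ∫ t : ℝ, ((τ ^ 2 + t ^ 2) ^ 2)⁻¹ :=
    fun i => by
    by_cases hij : i = j
    · simpa only [hF, hij, if_true] using integral_sq_mul_priorFactor hτ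
    · simp only [hF, hij, if_false, one_mul]
  simp only [← hprod]
  refine ⟨Integrable.fintype_prod hint, ?_⟩
  rw [integral_fintype_prod_volume_eq_prod F]
  simp only [hval, Finset.prod_mul_distrib, Finset.prod_ite_eq', Finset.mem_univ, if_true]
  unfold priorWeight
  rw [integral_fintype_prod_volume_eq_prod fun (_ : Fin M) t => ((τ ^ 2 + t ^ 2) ^ 2)⁻¹]

lemma unnormalizedPrior_univ (hτ : 0 < τ) (r : ℝ) :
    unnormalizedPrior M τ r Set.univ
      = ENNReal.ofReal (∫ w in {w : Fin M → ℝ | l1Norm w ≤ r}, priorWeight τ w) := by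
  rw [ofReal_integral_eq_lintegral_ofReal (integrable_priorWeight hτ).integrableOn
    (.of_forall fun w => (priorWeight_pos hτ w).le)]
  simp only [unnormalizedPrior, withDensity_apply _ MeasurableSet.univ, Measure.restrict_univ]
  rfl

lemma setIntegral_priorWeight_pos (hτ : 0 < τ) (hr : 0 < r) :
    0 < ∫ w in {w : Fin M → ℝ | l1Norm w ≤ r}, priorWeight τ w := by
  rw [setIntegral_pos_iff_support_of_nonneg_ae
    (.of_forall fun w => (priorWeight_pos hτ w).le) (integrable_priorWeight hτ).integrableOn]
  have h1 : Function.support (priorWeight τ : (Fin M → ℝ) → ℝ) = Set.univ := by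
    ext w; simp [(priorWeight_pos hτ w).ne']
  rw [h1, Set.univ_inter]
  have hopen : IsOpen {w : Fin M → ℝ | l1Norm w < r} :=
    isOpen_lt continuous_l1Norm continuous_const
  refine (hopen.measure_pos volume ⟨0, ?_⟩).trans_le (measure_mono fun w hw => ?_)
  · simpa [l1Norm] using hr
  · exact le_of_lt (Set.mem_ofPred.1 hw)

/-- Chebyshev's inequality: outside the ball `∑ w_j² ≥ 4Mτ²`, whereas its mean under the normalized
weight is `Mτ²`. So at most a quarter of the mass escapes. -/
lemma integral_priorWeight_le (hτ : 0 < τ) (hM : 0 < M) :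
    3 / 4 * (∫ w : Fin M → ℝ, priorWeight τ w)
      ≤ ∫ w in {w : Fin M → ℝ | l1Norm w ≤ 2 * M * τ}, priorWeight τ w := by
  have hM' : (0 : ℝ) < M := by exact_mod_cast hM
  set T := ∫ w : Fin M → ℝ, priorWeight τ w with hT
  have hsplit := integral_add_compl (measurableSet_ball (M := M) (2 * M * τ))
    (integrable_priorWeight (M := M) hτ)
  have hi : Integrable fun w : Fin M → ℝ => ∑ j, w j ^ 2 * priorWeight τ w :=
    integrable_finsetSum _ fun j _ => (integrable_and_integral_sq_mul_priorWeight hτ j).1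
  have hcompl : ∫ w in {w : Fin M → ℝ | l1Norm w ≤ 2 * M * τ}ᶜ, priorWeight τ w
      ≤ ∫ w : Fin M → ℝ, 1 / (4 * M * τ ^ 2) * ∑ j, w j ^ 2 * priorWeight τ w := by
    refine (setIntegral_mono_on (integrable_priorWeight hτ).integrableOn
      (hi.const_mul _).integrableOn (measurableSet_ball _).compl fun w hw => ?_).trans
      (setIntegral_le_integral (hi.const_mul _) (.of_forall fun w => ?_))
    · have hw' : 2 * M * τ < l1Norm w := not_le.1 hw
      have h1 : (2 * M * τ) ^ 2 ≤ l1Norm w ^ 2 := by gcongr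
      have h2 : l1Norm w ^ 2 ≤ M * ∑ j, w j ^ 2 := by
        have := sq_sum_le_card_mul_sum_sq (s := Finset.univ) (f := fun j => |w j|)
        simpa [l1Norm] using this
      have h3 : 1 ≤ 1 / (4 * M * τ ^ 2) * ∑ j, w j ^ 2 := by
        rw [one_div_mul_eq_div, le_div_iff₀ (by positivity)]
        have : M * (4 * M * τ ^ 2) ≤ M * ∑ j, w j ^ 2 := by linarith
        linarith [le_of_mul_le_mul_left this hM']
      rw [← Finset.sum_mul, ← mul_assoc]
      exact le_mul_of_one_le_left (priorWeight_pos hτ w).le h3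
    · have := priorWeight_pos hτ w
      exact mul_nonneg (by positivity) (Finset.sum_nonneg fun j _ => by positivity)
  rw [integral_const_mul, integral_finsetSum _ fun j _ =>
    (integrable_and_integral_sq_mul_priorWeight hτ j).1] at hcompl
  simp only [(integrable_and_integral_sq_mul_priorWeight hτ _).2, Finset.sum_const,
    Finset.card_univ, Fintype.card_fin, nsmul_eq_mul] at hcompl
  have h1 : 1 / (4 * M * τ ^ 2) * (M * (τ ^ 2 * T)) = T / 4 := by field_simp
  rw [h1] at hcompl
  linarith

lemma isProbabilityMeasure_sparsityPrior (hτ : 0 < τ) (hr : 0 < r) :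
    IsProbabilityMeasure (sparsityPrior M τ r) := by
  refine ⟨?_⟩
  simp only [sparsityPrior, Measure.smul_apply, smul_eq_mul]
  refine ENNReal.inv_mul_cancel ?_ ?_ <;> rw [unnormalizedPrior_univ hτ]
  · exact (ENNReal.ofReal_pos.2 (setIntegral_priorWeight_pos hτ hr)).ne'
  · exact ENNReal.ofReal_ne_top

lemma ae_l1Norm_le_sparsityPrior (M : ℕ) (τ r : ℝ) :
    ∀ᵐ w ∂(sparsityPrior M τ r), l1Norm w ≤ r := by
  refine Measure.ae_smul_measure ?_ _
  exact (withDensity_absolutelyContinuous _ _).ae_le (ae_restrict_mem (measurableSet_ball r))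

lemma integral_sparsityPrior (hτ : 0 < τ) (hr : 0 < r) (g : (Fin M → ℝ) → ℝ) :
    ∫ w, g w ∂(sparsityPrior M τ r)
      = (∫ w in {w : Fin M → ℝ | l1Norm w ≤ r}, priorWeight τ w)⁻¹
        * ∫ w in {w : Fin M → ℝ | l1Norm w ≤ r}, priorWeight τ w * g w := by
  rw [sparsityPrior, integral_smul_measure, ENNReal.toReal_inv, unnormalizedPrior_univ hτ,
    ENNReal.toReal_ofReal (setIntegral_priorWeight_pos hτ hr).le, smul_eq_mul]
  congr 1
  rw [unnormalizedPrior, integral_withDensity_eq_integral_toReal_smul (by fun_prop) (by simp)]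
  congr 1 with w
  change (ENNReal.ofReal (priorWeight τ w)).toReal • g w = _
  rw [ENNReal.toReal_ofReal (priorWeight_pos hτ w).le, smul_eq_mul]

/-- The change of sign of the `j`-th coordinate. -/
def flipSign (j : Fin M) (w : Fin M → ℝ) : Fin M → ℝ := fun i => if i = j then -w i else w i

lemma measurePreserving_flipSign (j : Fin M) :
    MeasurePreserving (flipSign j) (volume : Measure (Fin M → ℝ)) volume := by
  refine measurePreserving_pi (fun _ : Fin M => (volume : Measure ℝ)) (fun _ => volume)
    (f := fun i t => if i = j then -t else t) fun i => ?_
  by_cases h : i = j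
  · simpa only [h, if_true] using Measure.measurePreserving_neg (volume : Measure ℝ)
  · simp only [h, if_false]
    exact MeasurePreserving.id (volume : Measure ℝ)

/-- A sign change of one coordinate preserves Lebesgue measure, the `ℓ¹` ball and the weight. -/
lemma integral_sparsityPrior_eq_zero_of_odd (hτ : 0 < τ) (hr : 0 < r) (j : Fin M)
    {g : (Fin M → ℝ) → ℝ} (hg : Measurable g) (hodd : ∀ w, g (flipSign j w) = -g w) :
    ∫ w, g w ∂(sparsityPrior M τ r) = 0 := by
  rw [integral_sparsityPrior hτ hr, ← integral_indicator
    (f := fun w => priorWeight τ w * g w) (measurableSet_ball r)]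
  set G := {w : Fin M → ℝ | l1Norm w ≤ r}.indicator fun w => priorWeight τ w * g w with hG
  have hGm : Measurable G := (measurable_priorWeight.mul hg).indicator (measurableSet_ball r)
  have hl1 : ∀ w : Fin M → ℝ, l1Norm (flipSign j w) = l1Norm w := fun w => by
    unfold l1Norm flipSign
    refine Finset.sum_congr rfl fun i _ => ?_
    split_ifs <;> simp
  have hW : ∀ w : Fin M → ℝ, priorWeight τ (flipSign j w) = priorWeight τ w := fun w => by
    unfold priorWeight flipSign
    refine Finset.prod_congr rfl fun i _ => ?_
    split_ifs <;> simp
  have hGodd : ∀ w, G (flipSign j w) = -G w := fun w => by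
    simp only [hG, Set.indicator, Set.mem_ofPred_eq, hl1, hW, hodd]
    split_ifs <;> simp
  have h1 : ∫ w, G w = ∫ w, G (flipSign j w) := by
    conv_lhs => rw [← (measurePreserving_flipSign j).map_eq]
    exact integral_map (measurePreserving_flipSign j).aemeasurable hGm.aestronglyMeasurable
  simp only [hGodd, integral_neg] at h1
  rw [show ∫ w, G w = 0 by linarith, mul_zero]

lemma integral_apply_sparsityPrior (hτ : 0 < τ) (hr : 0 < r) (j : Fin M) :
    ∫ w, w j ∂(sparsityPrior M τ r) = 0 :=
  integral_sparsityPrior_eq_zero_of_odd hτ hr j (measurable_pi_apply j) fun w => by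
    simp [flipSign]

lemma integral_mul_sparsityPrior (hτ : 0 < τ) (hr : 0 < r) {j k : Fin M} (hjk : j ≠ k) :
    ∫ w, w j * w k ∂(sparsityPrior M τ r) = 0 :=
  integral_sparsityPrior_eq_zero_of_odd hτ hr j
    ((measurable_pi_apply j).mul (measurable_pi_apply k)) fun w => by
    simp [flipSign, hjk.symm]

/-- The full second moment `τ²` divided by the retained mass `3/4` already gives `4τ²/3`. -/
lemma integral_sq_sparsityPrior_le (hτ : 0 < τ) (hM : 0 < M) (j : Fin M) :
    ∫ w, w j ^ 2 ∂(sparsityPrior M τ (2 * M * τ)) ≤ 4 * τ ^ 2 := by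
  have hr : 0 < 2 * M * τ := by positivity
  have hC := setIntegral_priorWeight_pos (M := M) hτ hr
  have hT := integral_priorWeight_le hτ hM
  obtain ⟨hi, hj⟩ := integrable_and_integral_sq_mul_priorWeight hτ j
  rw [integral_sparsityPrior hτ hr, inv_mul_le_iff₀ hC]
  have h1 : ∫ w in {w : Fin M → ℝ | l1Norm w ≤ 2 * M * τ}, priorWeight τ w * w j ^ 2
      ≤ ∫ w : Fin M → ℝ, w j ^ 2 * priorWeight τ w := by
    simp only [mul_comm (priorWeight τ _)]
    refine setIntegral_le_integral hi (.of_forall fun w => ?_)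
    exact mul_nonneg (sq_nonneg _) (priorWeight_pos hτ w).le
  rw [hj] at h1
  nlinarith [sq_nonneg τ]

/-! ### Translates of the prior -/

lemma priorWeight_sub_le (hτ : 0 < τ) (u v : Fin M → ℝ) :
    priorWeight τ (u - v)
      ≤ Real.exp (4 * ∑ j, Real.log (1 + τ⁻¹ * |v j|)) * priorWeight τ u := by
  have h1 : Real.exp (4 * ∑ j, Real.log (1 + τ⁻¹ * |v j|)) = ∏ j, (1 + τ⁻¹ * |v j|) ^ 4 := by
    rw [Finset.mul_sum, Real.exp_sum]
    refine Finset.prod_congr rfl fun j _ => ?_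
    rw [show (4 : ℝ) = ((4 : ℕ) : ℝ) by norm_num, Real.exp_nat_mul,
      Real.exp_log (by positivity)]
  rw [h1, priorWeight, priorWeight, ← Finset.prod_mul_distrib]
  refine Finset.prod_le_prod (fun j _ => by positivity) fun j _ => ?_
  rw [Pi.sub_apply]
  set a := u j - v j with ha
  have hu : u j = a + v j := by rw [ha]; ring
  rw [hu, ← div_eq_mul_inv, le_div_iff₀ (by positivity), inv_mul_le_iff₀ (by positivity)]
  -- Heavy tails at work: a shift by `v_j` costs only a polynomial factor; squaring gives the fourth
  -- power, hence the constant 4 before the logarithms.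
  have h2 : τ ^ 2 + (a + v j) ^ 2 ≤ (τ ^ 2 + a ^ 2) * (1 + τ⁻¹ * |v j|) ^ 2 := by
    set s := τ⁻¹ * |v j| with hs
    have hv : |v j| = τ * s := by rw [hs]; field_simp
    have hs0 : 0 ≤ s := by positivity
    have h3 : (a + v j) ^ 2 ≤ (|a| + τ * s) ^ 2 := by
      rw [← sq_abs (a + v j), ← hv]
      gcongr
      exact abs_add_le _ _
    have h4 : a ^ 2 = |a| ^ 2 := (sq_abs a).symm
    rw [h4]
    nlinarith [mul_nonneg hs0 (sq_nonneg (τ - |a|)), mul_nonneg hs0 (sq_nonneg τ),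
      mul_nonneg hs0 (sq_nonneg |a|), mul_nonneg (sq_nonneg s) (sq_nonneg |a|)]
  calc (τ ^ 2 + (a + v j) ^ 2) ^ 2
      ≤ ((τ ^ 2 + a ^ 2) * (1 + τ⁻¹ * |v j|) ^ 2) ^ 2 := by gcongr
    _ = _ := by ring

lemma map_add_withDensity_volume (g : (Fin M → ℝ) → ℝ≥0∞) (v : Fin M → ℝ) :
    ((volume : Measure (Fin M → ℝ)).withDensity g).map (fun w => w + v)
      = (volume : Measure (Fin M → ℝ)).withDensity fun u => g (u - v) := by
  ext A hA
  have hm : Measurable fun w : Fin M → ℝ => w + v := measurable_id.add_const v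
  rw [Measure.map_apply hm hA, withDensity_apply _ (hm hA), withDensity_apply _ hA,
    ← lintegral_indicator (hm hA), ← lintegral_indicator hA,
    ← lintegral_add_right_eq_self (A.indicator fun u => g (u - v)) v]
  refine lintegral_congr fun w => ?_
  simp only [Set.indicator, add_sub_cancel_right]
  rfl

/-- The translate of a concentrated prior is dominated by the sparsity prior. -/
lemma map_add_sparsityPrior_le (hτ : 0 < τ) (hM : 0 < M) {v : Fin M → ℝ}
    (hv : l1Norm v ≤ R - 2 * M * τ) :
    (sparsityPrior M τ (2 * M * τ)).map (fun w => w + v)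
      ≤ ENNReal.ofReal (Real.exp (4 * (∑ j, Real.log (1 + τ⁻¹ * |v j|)) + 1))
        • sparsityPrior M τ R := by
  have hr : 0 < 2 * M * τ := by positivity
  have hR : 0 < R := by linarith [l1Norm_nonneg v]
  set K := Real.exp (4 * ∑ j, Real.log (1 + τ⁻¹ * |v j|)) with hK
  have hgm : ∀ r : ℝ, Measurable ({w : Fin M → ℝ | l1Norm w ≤ r}.indicator fun w =>
      ENNReal.ofReal (priorWeight τ w)) := fun r =>
    measurable_priorWeight.ennreal_ofReal.indicator (measurableSet_ball r)
  have h1 : (unnormalizedPrior M τ (2 * M * τ)).map (fun w => w + v)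
      ≤ ENNReal.ofReal K • unnormalizedPrior M τ R := by
    rw [unnormalizedPrior_eq, unnormalizedPrior_eq, map_add_withDensity_volume,
      ← withDensity_smul _ (hgm _)]
    refine withDensity_mono (.of_forall fun u => ?_)
    simp only [Set.indicator, Set.mem_ofPred_eq, Pi.smul_apply, smul_eq_mul]
    split_ifs with h2 h3
    · rw [← ENNReal.ofReal_mul (Real.exp_pos _).le]
      exact ENNReal.ofReal_le_ofReal (priorWeight_sub_le hτ u v)
    -- The translated small ball lies in the ball of radius `R` because `‖v‖₁ + 2Mτ ≤ R`.
    · exfalso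
      refine h3 ?_
      have := l1Norm_add_le (u - v) v
      rw [sub_add_cancel] at this
      linarith
    · exact zero_le
    · simp
  set C := unnormalizedPrior M τ (2 * M * τ) Set.univ with hC
  set D := unnormalizedPrior M τ R Set.univ with hD
  have hD0 : D ≠ 0 := by
    rw [hD, unnormalizedPrior_univ hτ]
    exact (ENNReal.ofReal_pos.2 (setIntegral_priorWeight_pos hτ hR)).ne'
  have hDtop : D ≠ ∞ := by rw [hD, unnormalizedPrior_univ hτ]; exact ENNReal.ofReal_ne_top
  have hC0 : C ≠ 0 := by
    rw [hC, unnormalizedPrior_univ hτ]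
    exact (ENNReal.ofReal_pos.2 (setIntegral_priorWeight_pos hτ hr)).ne'
  have hCtop : C ≠ ∞ := by rw [hC, unnormalizedPrior_univ hτ]; exact ENNReal.ofReal_ne_top
  -- The ratio of normalizing constants is at most `4/3`, rounded up to `e` so that its logarithm
  -- contributes the `+ 1`.
  have hDC : D ≤ ENNReal.ofReal (Real.exp 1) * C := by
    rw [hD, hC, unnormalizedPrior_univ hτ, unnormalizedPrior_univ hτ,
      ← ENNReal.ofReal_mul (Real.exp_pos _).le]
    refine ENNReal.ofReal_le_ofReal ?_
    have h2 := integral_priorWeight_le hτ hM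
    have h3 := setIntegral_priorWeight_pos (M := M) hτ hr
    have h4 : ∫ w in {w : Fin M → ℝ | l1Norm w ≤ R}, priorWeight τ w
        ≤ ∫ w : Fin M → ℝ, priorWeight τ w :=
      setIntegral_le_integral (integrable_priorWeight hτ)
        (.of_forall fun w => (priorWeight_pos hτ w).le)
    have h5 := Real.add_one_le_exp (1 : ℝ)
    nlinarith
  have h2 : unnormalizedPrior M τ R = D • sparsityPrior M τ R := by
    rw [sparsityPrior, smul_smul, ENNReal.mul_inv_cancel hD0 hDtop, one_smul]
  calc (sparsityPrior M τ (2 * M * τ)).map (fun w => w + v)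
      = C⁻¹ • (unnormalizedPrior M τ (2 * M * τ)).map (fun w => w + v) := by
        rw [sparsityPrior, Measure.map_smul]
    _ ≤ C⁻¹ • ENNReal.ofReal K • D • sparsityPrior M τ R := by
        rw [← h2]; gcongr
    _ = (C⁻¹ * (ENNReal.ofReal K * D)) • sparsityPrior M τ R := by simp only [smul_smul]
    _ ≤ _ := by
        gcongr
        rw [Real.exp_add, ENNReal.ofReal_mul (Real.exp_pos _).le, ← hK]
        calc C⁻¹ * (ENNReal.ofReal K * D)
            ≤ C⁻¹ * (ENNReal.ofReal K * (ENNReal.ofReal (Real.exp 1) * C)) := by gcongr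
          _ = ENNReal.ofReal K * ENNReal.ofReal (Real.exp 1) * (C⁻¹ * C) := by ring
          _ = _ := by rw [ENNReal.inv_mul_cancel hC0 hCtop, mul_one]

end MirrorAveraging

/-! ### The aggregate as a vector of coefficients; measurability and risk -/

namespace MirrorAveraging

variable {X : Type*} [MeasurableSpace X] {μ P : Measure X}
variable {M n : ℕ} {φ : Fin M → X → ℝ} {f : X → ℝ} {L R β τ : ℝ}

section measurability

lemma measurable_expWeight (hφm : ∀ j, Measurable (φ j)) (hφ : ∀ j, MemLp (φ j) 2 μ) (m : ℕ) :
    Measurable fun p : (Fin n → X) × (Fin M → ℝ) => expWeight μ φ β p.1 m p.2 := by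
  have h : ∀ i : Fin n, Measurable fun p : (Fin n → X) × (Fin M → ℝ) =>
      contrast μ (p.1 i) (combination φ p.2) := fun i =>
    Measurable.comp (g := fun q : X × (Fin M → ℝ) => contrast μ q.1 (combination φ q.2))
      (f := fun p : (Fin n → X) × (Fin M → ℝ) => (p.1 i, p.2)) (measurable_contrast hφm hφ)
      (((measurable_pi_apply i).comp measurable_fst).prodMk measurable_snd)
  unfold expWeight
  exact Real.measurable_exp.comp ((Finset.measurable_sum _ fun i _ => h i).const_mul _)

lemma measurable_integral_expWeight (hφm : ∀ j, Measurable (φ j)) (hφ : ∀ j, MemLp (φ j) 2 μ)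
    (m : ℕ) (π : Measure (Fin M → ℝ)) [SFinite π] :
    Measurable fun Z : Fin n → X => ∫ w, expWeight μ φ β Z m w ∂π :=
  ((measurable_expWeight hφm hφ m).stronglyMeasurable.integral_prod_right (f := fun Z w =>
    expWeight μ φ β Z m w)).measurable

lemma measurable_posteriorDensity (hφm : ∀ j, Measurable (φ j)) (hφ : ∀ j, MemLp (φ j) 2 μ)
    (m : ℕ) (π : Measure (Fin M → ℝ)) [SFinite π] :
    Measurable fun p : (Fin n → X) × (Fin M → ℝ) => posteriorDensity μ φ π β p.1 m p.2 :=
  (measurable_expWeight hφm hφ m).div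
    ((measurable_integral_expWeight hφm hφ m π).comp measurable_fst)

lemma continuous_expWeight (hφ : ∀ j, MemLp (φ j) 2 μ) (Z : Fin n → X) (m : ℕ) :
    Continuous fun w => expWeight μ φ β Z m w := by
  have h1 := continuous_integral_sq_combination hφ
  have h2 : ∀ x, Continuous fun w => combination φ w x := fun x => by
    unfold combination; fun_prop
  unfold expWeight contrast
  fun_prop

lemma isCompact_ball (R : ℝ) : IsCompact {w : Fin M → ℝ | l1Norm w ≤ R} := by
  refine Metric.isCompact_of_isClosed_isBounded
    (isClosed_le continuous_l1Norm continuous_const) ?_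
  refine (Metric.isBounded_closedBall (x := (0 : Fin M → ℝ)) (r := max R 0)).subset fun w hw => ?_
  rw [mem_closedBall_zero_iff, pi_norm_le_iff_of_nonneg (le_max_right _ _)]
  exact fun j => (abs_le_l1Norm w j).trans ((Set.mem_ofPred.1 hw).trans (le_max_left _ _))

lemma integrable_of_continuous {π : Measure (Fin M → ℝ)} [IsFiniteMeasure π]
    (hπ : ∀ᵐ w ∂π, l1Norm w ≤ R) {g : (Fin M → ℝ) → ℝ} (hg : Continuous g) : Integrable g π := by
  obtain ⟨C, hC⟩ := (isCompact_ball (M := M) R).exists_bound_of_continuousOn hg.continuousOn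
  exact Integrable.of_bound hg.measurable.aestronglyMeasurable C (hπ.mono fun w hw => hC w hw)

/-- The coefficients of the mirror averaging aggregate on the dictionary. -/
noncomputable def aggregateVector (μ : Measure X) (φ : Fin M → X → ℝ) (π : Measure (Fin M → ℝ))
    (β : ℝ) (Z : Fin n → X) : Fin M → ℝ :=
  fun j => ∫ w, w j * averagedDensity μ φ π β Z w ∂π

/-- All dependence on the sample passes through finitely many coefficients, so measurability of the
loss reduces to continuity of the risk on `ℝ^M`. -/
lemma maAggregate_eq_combination (hφ : ∀ j, MemLp (φ j) 2 μ) {π : Measure (Fin M → ℝ)}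
    [IsFiniteMeasure π] (hπ : ∀ᵐ w ∂π, l1Norm w ≤ R) (Z : Fin n → X) (x : X) :
    maAggregate μ φ π β Z x = combination φ (aggregateVector μ φ π β Z) x := by
  have h : ∀ w, combination φ w x * averagedDensity μ φ π β Z w
      = ∑ j, w j * averagedDensity μ φ π β Z w * φ j x := fun w => by
    rw [combination, Finset.sum_mul]
    exact Finset.sum_congr rfl fun j _ => by ring
  have hcont : Continuous fun w => averagedDensity μ φ π β Z w := by
    have h1 := continuous_expWeight (β := β) hφ Z
    unfold averagedDensity posteriorDensity
    fun_prop
  have hi : ∀ j, Integrable (fun w : Fin M → ℝ => w j * averagedDensity μ φ π β Z w) π :=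
    fun j => integrable_of_continuous hπ (by fun_prop)
  rw [maAggregate, integral_congr_ae (.of_forall h)]
  simp only [combination, aggregateVector]
  rw [integral_finsetSum _ fun j _ => (hi j).mul_const _]
  simp only [integral_mul_const]

lemma measurable_aggregateVector (hφm : ∀ j, Measurable (φ j)) (hφ : ∀ j, MemLp (φ j) 2 μ)
    (π : Measure (Fin M → ℝ)) [SFinite π] :
    Measurable fun Z : Fin n → X => aggregateVector μ φ π β Z := by
  refine measurable_pi_iff.2 fun j => ?_
  have h : Measurable fun p : (Fin n → X) × (Fin M → ℝ) =>
      p.2 j * averagedDensity μ φ π β p.1 p.2 := by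
    unfold averagedDensity
    refine ((measurable_pi_apply j).comp measurable_snd).mul
      ((Finset.measurable_sum _ fun m _ => ?_).const_mul _)
    exact measurable_posteriorDensity hφm hφ m π
  exact (h.stronglyMeasurable.integral_prod_right (f := fun Z w =>
    w j * averagedDensity μ φ π β Z w)).measurable

/-- The real-valued squared loss of a linear combination. -/
noncomputable def risk (μ : Measure X) (φ : Fin M → X → ℝ) (f : X → ℝ) (v : Fin M → ℝ) : ℝ :=
  ∫ x, (combination φ v x - f x) ^ 2 ∂μ

lemma risk_nonneg (v : Fin M → ℝ) : 0 ≤ risk μ φ f v := integral_nonneg fun _ => sq_nonneg _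

lemma sqLoss_combination (hφ : ∀ j, MemLp (φ j) 2 μ) (hf : MemLp f 2 μ) (v : Fin M → ℝ) :
    sqLoss μ (combination φ v) f = ENNReal.ofReal (risk μ φ f v) :=
  (ofReal_integral_eq_lintegral_ofReal ((memLp_combination hφ v).sub hf).integrable_sq
    (.of_forall fun _ => sq_nonneg _)).symm

lemma risk_eq (hφ : ∀ j, MemLp (φ j) 2 μ) (hf : MemLp f 2 μ) (v : Fin M → ℝ) :
    risk μ φ f v = (∫ x, combination φ v x ^ 2 ∂μ) - 2 * (∑ j, v j * ∫ x, f x * φ j x ∂μ)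
      + ∫ x, f x ^ 2 ∂μ := by
  have h := integral_sq_linear_combination (memLp_combination hφ v) hf hf 1 (-1) 0
  have h1 : ∀ x, 1 * combination φ v x + -1 * f x + 0 * f x = combination φ v x - f x :=
    fun x => by ring
  simp_rw [h1] at h
  have h2 : ∫ x, combination φ v x * f x ∂μ = ∑ j, v j * ∫ x, f x * φ j x ∂μ := by
    rw [← integral_mul_combination hφ hf]
    simp only [mul_comm]
  rw [risk, h, h2]
  ring

lemma continuous_risk (hφ : ∀ j, MemLp (φ j) 2 μ) (hf : MemLp f 2 μ) :
    Continuous (risk μ φ f) := by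
  have h := continuous_integral_sq_combination hφ
  have h1 : risk μ φ f = fun v => (∫ x, combination φ v x ^ 2 ∂μ)
      - 2 * (∑ j, v j * ∫ x, f x * φ j x ∂μ) + ∫ x, f x ^ 2 ∂μ := funext (risk_eq hφ hf)
  rw [h1]
  fun_prop

/-- The cross term `⟨f, f_v⟩` is the expectation of `f_v` under `P`, so the contrast is an unbiased
estimate of the risk minus `‖f‖²`. -/
lemma risk_eq_integral_contrast (hφ : ∀ j, MemLp (φ j) 2 μ) (hP : HasBoundedDensity μ P f L)
    (v : Fin M → ℝ) :
    risk μ φ f v = (∫ x, contrast μ x (combination φ v) ∂P) + ∫ x, f x ^ 2 ∂μ := by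
  have := hP.isProbabilityMeasure
  have h1 : ∫ x, combination φ v x ∂P = ∑ j, v j * ∫ x, f x * φ j x ∂μ := by
    rw [hP.integral_eq, integral_mul_combination hφ hP.memLp]
  have hi : Integrable (combination φ v) P :=
    (hP.memLp_two (memLp_combination hφ v)).integrable one_le_two
  unfold contrast
  rw [risk_eq hφ hP.memLp, integral_sub (integrable_const _) (hi.const_mul 2),
    integral_const_mul, h1]
  simp

/-- Convexity of the squared loss, in the pointwise Cauchy–Schwarz form. -/
lemma risk_average_le (hφ : ∀ j, MemLp (φ j) 2 μ) (hf : MemLp f 2 μ) (N : ℕ)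
    (v : ℕ → Fin M → ℝ) :
    risk μ φ f ((1 / ((N : ℝ) + 1)) • ∑ m ∈ Finset.range (N + 1), v m)
      ≤ 1 / ((N : ℝ) + 1) * ∑ m ∈ Finset.range (N + 1), risk μ φ f (v m) := by
  have hN : (0 : ℝ) < (N : ℝ) + 1 := by positivity
  have hi : ∀ u : Fin M → ℝ, Integrable (fun x => (combination φ u x - f x) ^ 2) μ := fun u =>
    ((memLp_combination hφ u).sub hf).integrable_sq
  unfold risk
  rw [← integral_finsetSum _ fun m _ => hi (v m), ← integral_const_mul]
  refine integral_mono (hi _) ((integrable_finsetSum _ fun m _ => hi (v m)).const_mul _)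
    fun x => ?_
  dsimp only
  have hcomb : ∀ s : Finset ℕ, combination φ (∑ m ∈ s, v m) x = ∑ m ∈ s, combination φ (v m) x := by
    intro s
    simp only [combination, Finset.sum_apply, Finset.sum_mul]
    exact Finset.sum_comm
  have h1 := sq_sum_le_card_mul_sum_sq (s := Finset.range (N + 1))
    (f := fun m => combination φ (v m) x - f x)
  rw [Finset.sum_sub_distrib, Finset.sum_const, Finset.card_range, nsmul_eq_mul] at h1
  push_cast at h1
  rw [combination_smul, hcomb]
  set A := ∑ m ∈ Finset.range (N + 1), combination φ (v m) x
  have h2 : (1 / ((N : ℝ) + 1) * A - f x) ^ 2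
      = (1 / ((N : ℝ) + 1)) ^ 2 * (A - ((N : ℝ) + 1) * f x) ^ 2 := by field_simp
  rw [h2]
  refine (mul_le_mul_of_nonneg_left h1 (by positivity)).trans (le_of_eq ?_)
  field_simp

theorem measurable_sqLoss_maAggregate (hφm : ∀ j, Measurable (φ j))
    (hφ : ∀ j, MemLp (φ j) 2 μ) (hf : MemLp f 2 μ) {π : Measure (Fin M → ℝ)} [IsFiniteMeasure π]
    (hπ : ∀ᵐ w ∂π, l1Norm w ≤ R) :
    Measurable fun Z : Fin n → X => sqLoss μ (maAggregate μ φ π β Z) f := by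
  have h : ∀ Z : Fin n → X, sqLoss μ (maAggregate μ φ π β Z) f
      = ENNReal.ofReal (risk μ φ f (aggregateVector μ φ π β Z)) := fun Z => by
    rw [← sqLoss_combination hφ hf, funext (maAggregate_eq_combination hφ hπ Z)]
  simp_rw [h]
  exact ((continuous_risk hφ hf).measurable.comp
    (measurable_aggregateVector hφm hφ π)).ennreal_ofReal

end measurability

/-! ### Posteriors and insertion of a fresh observation -/

/-- The posterior distribution based on the first `m` observations. -/
noncomputable def posterior (μ : Measure X) (φ : Fin M → X → ℝ) (π : Measure (Fin M → ℝ))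
    (β : ℝ) (Z : Fin n → X) (m : ℕ) : Measure (Fin M → ℝ) :=
  π.tilted fun w => -(1 / β) * ∑ i ∈ Finset.univ.filter (fun i : Fin n => (i : ℕ) < m),
    contrast μ (Z i) (combination φ w)

lemma integral_posterior (π : Measure (Fin M → ℝ)) (Z : Fin n → X) (m : ℕ)
    (g : (Fin M → ℝ) → ℝ) :
    ∫ w, g w ∂(posterior μ φ π β Z m) = ∫ w, posteriorDensity μ φ π β Z m w * g w ∂π :=
  integral_tilted _ g

lemma aggregateVector_eq_average (hφ : ∀ j, MemLp (φ j) 2 μ) {π : Measure (Fin M → ℝ)}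
    [IsFiniteMeasure π] (hπ : ∀ᵐ w ∂π, l1Norm w ≤ R) (Z : Fin n → X) :
    aggregateVector μ φ π β Z = (1 / ((n : ℝ) + 1)) •
      ∑ m ∈ Finset.range (n + 1), meanVector (posterior μ φ π β Z m) := by
  ext j
  have hi : ∀ m, Integrable (fun w : Fin M → ℝ => posteriorDensity μ φ π β Z m w * w j) π :=
    fun m => integrable_of_continuous hπ <| by
      have h1 := continuous_expWeight (β := β) hφ Z
      unfold posteriorDensity
      fun_prop
  have h : ∀ w : Fin M → ℝ, w j * averagedDensity μ φ π β Z w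
      = 1 / ((n : ℝ) + 1) * ∑ m ∈ Finset.range (n + 1), posteriorDensity μ φ π β Z m w * w j :=
    fun w => by
    rw [averagedDensity, ← Finset.sum_mul]
    ring
  simp only [aggregateVector, h, Pi.smul_apply, Finset.sum_apply, smul_eq_mul, meanVector,
    integral_posterior]
  rw [integral_const_mul, integral_finsetSum _ fun m _ => hi m]

/-- Insertion at place `m` leaves the first `m` entries unchanged, so the posterior used for
prediction does not see the new observation. -/
lemma sum_filter_insertNth {Y : Type*} (g : Y → ℝ) (m : Fin (n + 1)) (x : Y) (Z : Fin n → Y) :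
    ∑ i ∈ Finset.univ.filter (fun i : Fin (n + 1) => (i : ℕ) < m),
        g ((m.insertNth x Z : Fin (n + 1) → Y) i)
      = ∑ i ∈ Finset.univ.filter (fun i : Fin n => (i : ℕ) < m), g (Z i) := by
  rw [Finset.sum_filter, Finset.sum_filter, Fin.sum_univ_succAbove _ m]
  simp only [lt_irrefl, if_false, zero_add, Fin.insertNth_apply_succAbove]
  refine Finset.sum_congr rfl fun i _ => ?_
  have h : ((m.succAbove i : Fin (n + 1)) : ℕ) < m ↔ (i : ℕ) < m := by
    unfold Fin.succAbove
    split_ifs with h1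
    · exact Iff.rfl
    · rw [Fin.lt_def, Fin.val_castSucc] at h1
      rw [Fin.val_succ]
      omega
  simp only [h]

lemma sum_filter_succ_insertNth {Y : Type*} (g : Y → ℝ) (m : Fin (n + 1)) (x : Y) (Z : Fin n → Y) :
    ∑ i ∈ Finset.univ.filter (fun i : Fin (n + 1) => (i : ℕ) < m + 1),
        g ((m.insertNth x Z : Fin (n + 1) → Y) i)
      = g x + ∑ i ∈ Finset.univ.filter (fun i : Fin n => (i : ℕ) < m), g (Z i) := by
  rw [Finset.sum_filter, Finset.sum_filter, Fin.sum_univ_succAbove _ m]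
  simp only [Nat.lt_succ_self, if_true, Fin.insertNth_apply_same, Fin.insertNth_apply_succAbove]
  congr 1
  refine Finset.sum_congr rfl fun i _ => ?_
  have h : ((m.succAbove i : Fin (n + 1)) : ℕ) < m + 1 ↔ (i : ℕ) < m := by
    unfold Fin.succAbove
    split_ifs with h1 <;> rw [Fin.lt_def, Fin.val_castSucc] at h1
    · rw [Fin.val_castSucc]
      omega
    · rw [Fin.val_succ]
      omega
  simp only [h]

lemma expWeight_insertNth (m : Fin (n + 1)) (x : X) (Z : Fin n → X) (w : Fin M → ℝ) :
    expWeight μ φ β (m.insertNth x Z : Fin (n + 1) → X) m w = expWeight μ φ β Z m w := by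
  unfold expWeight
  rw [sum_filter_insertNth fun y => contrast μ y (combination φ w)]

lemma expWeight_succ_insertNth (m : Fin (n + 1)) (x : X) (Z : Fin n → X) (w : Fin M → ℝ) :
    expWeight μ φ β (m.insertNth x Z : Fin (n + 1) → X) (m + 1) w
      = expWeight μ φ β Z m w * Real.exp (-(1 / β) * contrast μ x (combination φ w)) := by
  unfold expWeight
  rw [sum_filter_succ_insertNth fun y => contrast μ y (combination φ w), ← Real.exp_add]
  congr 1
  ring

namespace IsDictionary

lemma abs_log_expWeight_le (hφ : IsDictionary μ φ L) (hL : 0 ≤ L) (hR : 0 ≤ R) (hβ : 0 < β)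
    (Z : Fin n → X) (m : ℕ) {w : Fin M → ℝ} (hw : l1Norm w ≤ R) :
    |-(1 / β) * ∑ i ∈ Finset.univ.filter (fun i : Fin n => (i : ℕ) < m),
      contrast μ (Z i) (combination φ w)| ≤ 1 / β * (n * (R ^ 2 + 2 * R * L)) := by
  rw [abs_mul, abs_neg, abs_of_pos (by positivity : 0 < 1 / β)]
  gcongr
  refine (Finset.abs_sum_le_sum_abs _ _).trans ?_
  refine (Finset.sum_le_sum fun i _ => hφ.abs_contrast_le hL hw (Z i)).trans ?_
  rw [Finset.sum_const, nsmul_eq_mul]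
  gcongr
  exact_mod_cast (Finset.card_filter_le _ _).trans (by simp)

lemma abs_log_integral_expWeight_le (hφ : IsDictionary μ φ L) (hL : 0 ≤ L) (hR : 0 ≤ R)
    (hβ : 0 < β) {π : Measure (Fin M → ℝ)} [IsProbabilityMeasure π]
    (hπ : ∀ᵐ w ∂π, l1Norm w ≤ R) (Z : Fin n → X) (m : ℕ) :
    0 < ∫ w, expWeight μ φ β Z m w ∂π ∧
      |Real.log (∫ w, expWeight μ φ β Z m w ∂π)| ≤ 1 / β * (n * (R ^ 2 + 2 * R * L)) := by
  set c := 1 / β * (n * (R ^ 2 + 2 * R * L)) with hc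
  have hi : Integrable (fun w => expWeight μ φ β Z m w) π :=
    integrable_of_continuous hπ (continuous_expWeight hφ.memLp Z m)
  have hlow : Real.exp (-c) ≤ ∫ w, expWeight μ φ β Z m w ∂π := by
    have h := integral_mono_ae (integrable_const (Real.exp (-c))) hi (hπ.mono fun w hw =>
      Real.exp_le_exp.2 (neg_le_of_abs_le (hφ.abs_log_expWeight_le hL hR hβ Z m hw)))
    simpa only [integral_const, probReal_univ, one_smul] using h
  have hup : ∫ w, expWeight μ φ β Z m w ∂π ≤ Real.exp c := by
    have h := integral_mono_ae hi (integrable_const (Real.exp c)) (hπ.mono fun w hw =>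
      Real.exp_le_exp.2 (le_of_abs_le (hφ.abs_log_expWeight_le hL hR hβ Z m hw)))
    simpa only [integral_const, probReal_univ, one_smul] using h
  have hpos := (Real.exp_pos _).trans_le hlow
  exact ⟨hpos, abs_le.2 ⟨(Real.le_log_iff_exp_le hpos).2 hlow,
    (Real.log_le_iff_le_exp hpos).2 hup⟩⟩

end IsDictionary

end MirrorAveraging

/-! ### Telescoping the step bounds -/

namespace MirrorAveraging

variable {X : Type*} [MeasurableSpace X] {μ P : Measure X}
variable {M n : ℕ} {φ : Fin M → X → ℝ} {f : X → ℝ} {L R β τ : ℝ}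

/-- An independent draw inserted at any place of an i.i.d. `n`-sample yields an i.i.d.
`(n+1)`-sample. This puts all step bounds on one sample space. -/
lemma integral_piFinSuccAbove [IsProbabilityMeasure P] (m : Fin (n + 1))
    {G : (Fin (n + 1) → X) → ℝ} (hG : Integrable G (Measure.pi fun _ => P)) :
    Integrable (fun Z : Fin n → X => ∫ x, G (m.insertNth x Z) ∂P) (Measure.pi fun _ => P) ∧
    ∫ Z : Fin n → X, ∫ x, G (m.insertNth x Z) ∂P ∂(Measure.pi fun _ => P)
      = ∫ ω, G ω ∂(Measure.pi fun _ => P) := by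
  have hmp := (measurePreserving_piFinSuccAbove (fun _ : Fin (n + 1) => P) m).symm
  have hG' : Integrable (fun p : X × (Fin n → X) => G (m.insertNth p.1 p.2))
      (P.prod (Measure.pi fun _ => P)) :=
    (hmp.integrable_comp_emb (MeasurableEquiv.measurableEmbedding _)).2 hG
  refine ⟨hG'.integral_prod_right, ?_⟩
  rw [← integral_integral_swap hG', ← integral_prod _ hG']
  exact hmp.integral_comp' G

lemma ae_l1Norm_le_posterior {π : Measure (Fin M → ℝ)} (hπ : ∀ᵐ w ∂π, l1Norm w ≤ R) (Z : Fin n → X) (m : ℕ) :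
    ∀ᵐ w ∂(posterior μ φ π β Z m), l1Norm w ≤ R :=
  (tilted_absolutelyContinuous π _).ae_le hπ

/-- Bayesian updating: the predictive exponential moment is a ratio of successive partition
functions, so its logarithm telescopes. -/
lemma integral_exp_contrast_posterior (π : Measure (Fin M → ℝ)) (m : Fin (n + 1)) (x : X)
    (Z : Fin n → X) :
    ∫ w, Real.exp (-(1 / β) * contrast μ x (combination φ w)) ∂(posterior μ φ π β Z m)
      = (∫ w, expWeight μ φ β (m.insertNth x Z : Fin (n + 1) → X) (m + 1) w ∂π)
        / ∫ w, expWeight μ φ β (m.insertNth x Z : Fin (n + 1) → X) m w ∂π := by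
  rw [integral_posterior]
  simp only [expWeight_insertNth, expWeight_succ_insertNth, posteriorDensity]
  rw [← integral_div]
  congr 1 with w
  ring

section posterior

variable {π : Measure (Fin M → ℝ)} [IsProbabilityMeasure π]

lemma isProbabilityMeasure_posterior (hφ : ∀ j, MemLp (φ j) 2 μ)
    (hπ : ∀ᵐ w ∂π, l1Norm w ≤ R) (Z : Fin n → X) (m : ℕ) :
    IsProbabilityMeasure (posterior μ φ π β Z m) :=
  isProbabilityMeasure_tilted (integrable_of_continuous hπ (continuous_expWeight hφ Z m))

lemma measurable_meanVector_posterior (hφm : ∀ j, Measurable (φ j))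
    (hφ : ∀ j, MemLp (φ j) 2 μ) (m : ℕ) :
    Measurable fun Z : Fin n → X => meanVector (posterior μ φ π β Z m) := by
  refine measurable_pi_iff.2 fun j => ?_
  simp only [meanVector, integral_posterior]
  have h : Measurable fun p : (Fin n → X) × (Fin M → ℝ) =>
      posteriorDensity μ φ π β p.1 m p.2 * p.2 j :=
    (measurable_posteriorDensity hφm hφ m π).mul ((measurable_pi_apply j).comp measurable_snd)
  exact (h.stronglyMeasurable.integral_prod_right (f := fun Z w =>
    posteriorDensity μ φ π β Z m w * w j)).measurable

namespace IsDictionary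

lemma integrable_log_integral_expWeight (hφ : IsDictionary μ φ L) [IsProbabilityMeasure P]
    (hL : 0 ≤ L) (hR : 0 ≤ R) (hβ : 0 < β) (hπ : ∀ᵐ w ∂π, l1Norm w ≤ R) (m : ℕ) :
    Integrable (fun Z : Fin n → X => Real.log (∫ w, expWeight μ φ β Z m w ∂π))
      (Measure.pi fun _ => P) :=
  Integrable.of_bound
    (measurable_integral_expWeight hφ.measurable hφ.memLp m π).log.aestronglyMeasurable
    (1 / β * (n * (R ^ 2 + 2 * R * L)))
    (.of_forall fun Z => (hφ.abs_log_integral_expWeight_le hL hR hβ hπ Z m).2)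

lemma integrable_risk_comp (hφ : IsDictionary μ φ L) (hP : HasBoundedDensity μ P f L)
    (hL : 0 ≤ L) {v : (Fin n → X) → Fin M → ℝ} (hv : Measurable v) (hvR : ∀ Z, l1Norm (v Z) ≤ R) :
    Integrable (fun Z => risk μ φ f (v Z)) (Measure.pi fun _ => P) := by
  have := hP.isProbabilityMeasure
  refine Integrable.of_bound
    ((continuous_risk hφ.memLp hP.memLp).measurable.comp hv).aestronglyMeasurable
    (R ^ 2 + 2 * R * L + ∫ x, f x ^ 2 ∂μ) (.of_forall fun Z => ?_)
  rw [Real.norm_of_nonneg (risk_nonneg _), risk_eq_integral_contrast hφ.memLp hP]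
  gcongr
  refine (le_abs_self _).trans ?_
  have h := norm_integral_le_of_norm_le_const (μ := P) (C := R ^ 2 + 2 * R * L)
    (f := fun x => contrast μ x (combination φ (v Z)))
    (.of_forall fun x => hφ.abs_contrast_le hL (hvR Z) x)
  simpa only [probReal_univ, mul_one, Real.norm_eq_abs] using h

lemma integral_risk_posterior_le (hφ : IsDictionary μ φ L)
    (hP : HasBoundedDensity μ P f L) (hL : 0 < L) (hR : 0 < R) (hβ0 : 0 < β)
    (hβ : 2 * L + 4 * R * L ≤ (β - 2 * R ^ 2) * Real.exp (-(4 * R * (L + √L)) / β))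
    (hπ : ∀ᵐ w ∂π, l1Norm w ≤ R) (m : Fin (n + 1)) :
    ∫ Z : Fin n → X, risk μ φ f (meanVector (posterior μ φ π β Z m)) ∂(Measure.pi fun _ => P) ≤
      -β * ((∫ ω : Fin (n + 1) → X, Real.log (∫ w, expWeight μ φ β ω (m + 1) w ∂π)
          ∂(Measure.pi fun _ => P))
        - ∫ ω : Fin (n + 1) → X, Real.log (∫ w, expWeight μ φ β ω m w ∂π)
          ∂(Measure.pi fun _ => P)) + ∫ x, f x ^ 2 ∂μ := by
  have := hP.isProbabilityMeasure
  set G : (Fin (n + 1) → X) → ℝ := fun ω => Real.log (∫ w, expWeight μ φ β ω (m + 1) w ∂π)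
    - Real.log (∫ w, expWeight μ φ β ω m w ∂π) with hG
  have hi1 := hφ.integrable_log_integral_expWeight (P := P) (n := n + 1) hL.le hR.le hβ0 hπ (m + 1)
  have hi2 := hφ.integrable_log_integral_expWeight (P := P) (n := n + 1) hL.le hR.le hβ0 hπ m
  obtain ⟨hGi, hGint⟩ := integral_piFinSuccAbove m (hi1.sub hi2)
  have hstep : ∀ Z : Fin n → X, risk μ φ f (meanVector (posterior μ φ π β Z m))
      ≤ -β * (∫ x, G (m.insertNth x Z) ∂P) + ∫ x, f x ^ 2 ∂μ := fun Z => by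
    have := isProbabilityMeasure_posterior (β := β) hφ.memLp hπ Z m
    have h1 := hφ.integral_contrast_meanVector_le hP hL hR hβ0 hβ
      (ae_l1Norm_le_posterior (μ := μ) (φ := φ) (β := β) hπ Z m)
    rw [risk_eq_integral_contrast hφ.memLp hP]
    refine add_le_add_left (h1.trans (le_of_eq ?_)) _
    congr 2 with x
    rw [integral_exp_contrast_posterior, Real.log_div
      (hφ.abs_log_integral_expWeight_le hL.le hR.le hβ0 hπ _ _).1.ne'
      (hφ.abs_log_integral_expWeight_le hL.le hR.le hβ0 hπ _ _).1.ne']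
  have hri : Integrable (fun Z : Fin n → X => risk μ φ f (meanVector (posterior μ φ π β Z m)))
      (Measure.pi fun _ => P) :=
    hφ.integrable_risk_comp hP hL.le (measurable_meanVector_posterior hφ.measurable hφ.memLp m)
      fun Z => by
        have := isProbabilityMeasure_posterior (β := β) hφ.memLp hπ Z m
        exact l1Norm_meanVector_le (ae_l1Norm_le_posterior hπ Z m)
  have h := integral_mono hri ((hGi.const_mul (-β)).add (integrable_const _)) hstep
  simp only [Pi.add_apply] at h
  rw [integral_add (hGi.const_mul (-β)) (integrable_const _), integral_const_mul] at h
  simp only [Pi.sub_apply] at hGint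
  rw [integral_sub hi1 hi2] at hGint
  simp only [Pi.sub_apply, integral_const, probReal_univ, one_smul] at h
  rw [hGint] at h
  exact h

/-- The cumulative risk of the posterior means is at most the expected cumulative mixability
loss. -/
lemma sum_integral_risk_posterior_le (hφ : IsDictionary μ φ L)
    (hP : HasBoundedDensity μ P f L) (hL : 0 < L) (hR : 0 < R) (hβ0 : 0 < β)
    (hβ : 2 * L + 4 * R * L ≤ (β - 2 * R ^ 2) * Real.exp (-(4 * R * (L + √L)) / β))
    (hπ : ∀ᵐ w ∂π, l1Norm w ≤ R) (n : ℕ) :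
    ∑ m ∈ Finset.range (n + 1), ∫ Z : Fin n → X,
        risk μ φ f (meanVector (posterior μ φ π β Z m)) ∂(Measure.pi fun _ => P) ≤
      -β * (∫ ω : Fin (n + 1) → X, Real.log (∫ w, expWeight μ φ β ω (n + 1) w ∂π)
          ∂(Measure.pi fun _ => P)) + (n + 1) * ∫ x, f x ^ 2 ∂μ := by
  set A : ℕ → ℝ := fun k => ∫ ω : Fin (n + 1) → X, Real.log (∫ w, expWeight μ φ β ω k w ∂π)
    ∂(Measure.pi fun _ => P) with hA
  -- With no observations the weight is 1 and `π` has mass 1.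
  have hA0 : A 0 = 0 := by simp [hA, expWeight]
  have h1 : ∀ m ∈ Finset.range (n + 1), ∫ Z : Fin n → X,
      risk μ φ f (meanVector (posterior μ φ π β Z m)) ∂(Measure.pi fun _ => P)
        ≤ -β * (A (m + 1) - A m) + ∫ x, f x ^ 2 ∂μ := fun m hm =>
    hφ.integral_risk_posterior_le hP hL hR hβ0 hβ hπ ⟨m, Finset.mem_range.1 hm⟩
  refine (Finset.sum_le_sum h1).trans (le_of_eq ?_)
  rw [Finset.sum_add_distrib, ← Finset.mul_sum, Finset.sum_range_sub, hA0, Finset.sum_const,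
    Finset.card_range, nsmul_eq_mul]
  push_cast
  ring

end IsDictionary

end posterior

/-! ### The log-partition function and the oracle inequality -/

namespace IsDictionary

/-- The mean of the contrast under the translate of a concentrated prior. -/
lemma integral_contrast_add_sparsityPrior_le (hφ : IsDictionary μ φ L) (hτ : 0 < τ) (hM : 0 < M)
    (v : Fin M → ℝ) (x : X) :
    ∫ w, contrast μ x (combination φ (w + v)) ∂(sparsityPrior M τ (2 * M * τ))
      ≤ contrast μ x (combination φ v) + 4 * τ ^ 2 * M := by
  have hr : 0 < 2 * M * τ := by positivity
  have := isProbabilityMeasure_sparsityPrior (M := M) hτ hr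
  set p := sparsityPrior M τ (2 * M * τ) with hp
  have hp1 := ae_l1Norm_le_sparsityPrior M τ (2 * M * τ)
  have hi1 : ∀ j, Integrable (fun w : Fin M → ℝ => w j) p := integrable_apply hp1
  have hi2 : ∀ j k, Integrable (fun w : Fin M → ℝ => w j * w k) p := fun j k =>
    integrable_of_continuous hp1 (by fun_prop)
  set b : Fin M → ℝ := fun j => 2 * (∫ y, combination φ v y * φ j y ∂μ) - 2 * φ j x with hb
  -- The contrast is quadratic in `w`: under the symmetric prior the linear part and the
  -- off-diagonal terms vanish, and the diagonal Gram entries are 1.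
  have hexp : ∀ w : Fin M → ℝ, contrast μ x (combination φ (w + v))
      = contrast μ x (combination φ v) + (∑ j, w j * b j)
        + ∑ j, ∑ k, w j * w k * ∫ y, φ j y * φ k y ∂μ := fun w => by
    have h1 := integral_sq_combination_segment hφ.memLp v w 1
    rw [one_smul, add_comm v w, integral_sq_combination hφ.memLp w,
      integral_mul_combination hφ.memLp (memLp_combination hφ.memLp v)] at h1
    have h2 : ∑ j, w j * b j = 2 * (∑ j, w j * ∫ y, combination φ v y * φ j y ∂μ)
        - 2 * combination φ w x := by
      simp only [combination, Finset.mul_sum, ← Finset.sum_sub_distrib, hb]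
      exact Finset.sum_congr rfl fun j _ => by ring
    unfold contrast
    rw [h1, h2, combination_add]
    ring
  have hL1 : ∫ w, ∑ j, w j * b j ∂p = 0 := by
    rw [integral_finsetSum _ fun j _ => (hi1 j).mul_const _]
    simp only [integral_mul_const, hp, integral_apply_sparsityPrior hτ hr, zero_mul,
      Finset.sum_const_zero]
  have hL2 : ∫ w, ∑ j, ∑ k, w j * w k * (∫ y, φ j y * φ k y ∂μ) ∂p ≤ 4 * τ ^ 2 * M := by
    rw [integral_finsetSum _ fun j _ => integrable_finsetSum _ fun k _ => (hi2 j k).mul_const _]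
    have h1 : ∀ j, ∫ w, ∑ k, w j * w k * (∫ y, φ j y * φ k y ∂μ) ∂p ≤ 4 * τ ^ 2 := fun j => by
      rw [integral_finsetSum _ fun k _ => (hi2 j k).mul_const _, Finset.sum_eq_single j]
      · have h2 := hφ.integral_sq j
        have h3 := integral_sq_sparsityPrior_le hτ hM j
        simp only [pow_two] at h2 h3
        rw [integral_mul_const, h2, mul_one, pow_two]
        exact h3
      · intro k _ hk
        rw [integral_mul_const, integral_mul_sparsityPrior hτ hr hk.symm, zero_mul]
      · simp
    refine (Finset.sum_le_sum fun j _ => h1 j).trans (le_of_eq ?_)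
    simp [mul_comm]
  have hs1 : Integrable (fun w : Fin M → ℝ => ∑ j, w j * b j) p :=
    integrable_finsetSum _ fun j _ => (hi1 j).mul_const _
  have hs2 : Integrable (fun w : Fin M → ℝ => ∑ j, ∑ k, w j * w k * ∫ y, φ j y * φ k y ∂μ) p :=
    integrable_finsetSum _ fun j _ => integrable_finsetSum _ fun k _ => (hi2 j k).mul_const _
  have hs0 : Integrable (fun w : Fin M → ℝ =>
      contrast μ x (combination φ v) + ∑ j, w j * b j) p := (integrable_const _).add hs1
  rw [integral_congr_ae (.of_forall hexp), integral_add hs0 hs2,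
    integral_add (integrable_const _) hs1, hL1]
  simp only [integral_const, probReal_univ, one_smul, add_zero]
  gcongr

/-- The variational bound for the log-partition function of the sparsity prior. -/
lemma neg_log_integral_expWeight_le (hφ : IsDictionary μ φ L) (hL : 0 < L)
    (hβ : 0 < β) (hτ : 0 < τ) (hM : 0 < M) {v : Fin M → ℝ} (hv : l1Norm v ≤ R - 2 * M * τ)
    (Z : Fin n → X) :
    -β * Real.log (∫ w, expWeight μ φ β Z n w ∂(sparsityPrior M τ R))
      ≤ β * (4 * (∑ j, Real.log (1 + τ⁻¹ * |v j|)) + 1)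
        + ∑ i, (contrast μ (Z i) (combination φ v) + 4 * τ ^ 2 * M) := by
  have hr : 0 < 2 * M * τ := by positivity
  have hR : 0 < R := by linarith [l1Norm_nonneg v]
  have := isProbabilityMeasure_sparsityPrior (M := M) hτ hr
  have := isProbabilityMeasure_sparsityPrior (M := M) hτ hR
  set c := 4 * (∑ j, Real.log (1 + τ⁻¹ * |v j|)) + 1 with hc
  set p := sparsityPrior M τ (2 * M * τ) with hp
  have hp1 : ∀ᵐ w ∂p, l1Norm w ≤ 2 * M * τ := ae_l1Norm_le_sparsityPrior M τ (2 * M * τ)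
  set π := sparsityPrior M τ R with hπ
  have hπ1 : ∀ᵐ w ∂π, l1Norm w ≤ R := ae_l1Norm_le_sparsityPrior M τ R
  have hcont := continuous_expWeight (β := β) hφ.memLp Z n
  have hpos := (hφ.abs_log_integral_expWeight_le hL.le hR.le hβ hπ1 Z n).1
  -- Domination of measures takes the place of a Kullback–Leibler divergence: its constant `exp c`
  -- becomes the price `β c`.
  have hdom : ∫ w, expWeight μ φ β Z n (w + v) ∂p
      ≤ Real.exp c * ∫ w, expWeight μ φ β Z n w ∂π := by
    have h1 := integral_mono_measure (f := fun w => expWeight μ φ β Z n w)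
      (map_add_sparsityPrior_le hτ hM hv) (.of_forall fun w => (Real.exp_pos _).le)
      ((integrable_of_continuous hπ1 hcont).smul_measure ENNReal.ofReal_ne_top)
    rwa [integral_map (by fun_prop) hcont.aestronglyMeasurable, integral_smul_measure,
      ENNReal.toReal_ofReal (Real.exp_pos _).le, smul_eq_mul] at h1
  set S : (Fin M → ℝ) → ℝ := fun w => -(1 / β) * ∑ i, contrast μ (Z i) (combination φ (w + v))
    with hS
  have hSexp : ∀ w, expWeight μ φ β Z n (w + v) = Real.exp (S w) := fun w => by
    have h1 : Finset.univ.filter (fun i : Fin n => (i : ℕ) < n) = Finset.univ :=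
      Finset.filter_true_of_mem fun i _ => i.isLt
    rw [expWeight, h1]
  have hcontr : ∀ x, Integrable (fun w => contrast μ x (combination φ (w + v))) p := fun x =>
    integrable_of_continuous hp1 <| by
      have h1 := continuous_integral_sq_combination hφ.memLp
      have h2 : Continuous fun w => combination φ w x := by unfold combination; fun_prop
      unfold contrast
      exact (h1.comp (continuous_id.add_const v)).sub
        ((h2.comp (continuous_id.add_const v)).const_mul 2)
  have hSi : Integrable S p := (integrable_finsetSum _ fun i _ => hcontr (Z i)).const_mul _
  have hjensen : Real.exp (∫ w, S w ∂p) ≤ ∫ w, expWeight μ φ β Z n (w + v) ∂p := by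
    have hi : Integrable (fun w => expWeight μ φ β Z n (w + v)) p :=
      integrable_of_continuous hp1 (hcont.comp (continuous_id.add_const v))
    simp only [hSexp] at hi ⊢
    exact convexOn_exp.map_integral_le Real.continuous_exp.continuousOn isClosed_univ (by simp)
      hSi hi
  have hlog : ∫ w, S w ∂p ≤ c + Real.log (∫ w, expWeight μ φ β Z n w ∂π) := by
    rw [← Real.log_exp c, ← Real.log_mul (Real.exp_ne_zero _) hpos.ne',
      Real.le_log_iff_exp_le (by positivity)]
    exact hjensen.trans hdom
  have hSint : -(1 / β) * ∑ i, (contrast μ (Z i) (combination φ v) + 4 * τ ^ 2 * M)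
      ≤ ∫ w, S w ∂p := by
    simp only [hS]
    rw [integral_const_mul, integral_finsetSum _ fun i _ => hcontr (Z i)]
    refine mul_le_mul_of_nonpos_left (Finset.sum_le_sum fun i _ =>
      hφ.integral_contrast_add_sparsityPrior_le hτ hM v (Z i)) ?_
    have : 0 < 1 / β := by positivity
    linarith
  have h1 := mul_le_mul_of_nonneg_left (hSint.trans hlog) hβ.le
  have h2 : β * (-(1 / β) * ∑ i, (contrast μ (Z i) (combination φ v) + 4 * τ ^ 2 * M))
      = -∑ i, (contrast μ (Z i) (combination φ v) + 4 * τ ^ 2 * M) := by field_simp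
  rw [h2] at h1
  linarith

/-- The sparsity oracle inequality in terms of real-valued risks. -/
theorem integral_risk_aggregateVector_le (hφ : IsDictionary μ φ L)
    (hP : HasBoundedDensity μ P f L) (hL : 0 < L) (hβ0 : 0 < β)
    (hβ : 2 * L + 4 * R * L ≤ (β - 2 * R ^ 2) * Real.exp (-(4 * R * (L + √L)) / β))
    (hτ : 0 < τ) (hM : 0 < M) {v : Fin M → ℝ} (hv : l1Norm v ≤ R - 2 * M * τ) (n : ℕ) :
    Integrable (fun Z : Fin n → X => risk μ φ f (aggregateVector μ φ (sparsityPrior M τ R) β Z))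
        (Measure.pi fun _ => P) ∧
      ∫ Z : Fin n → X, risk μ φ f (aggregateVector μ φ (sparsityPrior M τ R) β Z)
        ∂(Measure.pi fun _ => P) ≤
      risk μ φ f v + 4 * β / (n + 1) * (∑ j, Real.log (1 + τ⁻¹ * |v j|))
        + (4 * τ ^ 2 * M + β / (n + 1)) := by
  have hR : 0 < R := by
    have : 0 < 2 * M * τ := by positivity
    linarith [l1Norm_nonneg v]
  have := hP.isProbabilityMeasure
  have := isProbabilityMeasure_sparsityPrior (M := M) hτ hR
  set π := sparsityPrior M τ R with hπ
  have hπ1 : ∀ᵐ w ∂π, l1Norm w ≤ R := ae_l1Norm_le_sparsityPrior M τ R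
  have hn : (0 : ℝ) < (n : ℝ) + 1 := by positivity
  have hri : ∀ m : ℕ, Integrable (fun Z : Fin n → X =>
      risk μ φ f (meanVector (posterior μ φ π β Z m))) (Measure.pi fun _ => P) := fun m =>
    hφ.integrable_risk_comp hP hL.le (measurable_meanVector_posterior hφ.measurable hφ.memLp m)
      fun Z => by
        have := isProbabilityMeasure_posterior (β := β) hφ.memLp hπ1 Z m
        exact l1Norm_meanVector_le (ae_l1Norm_le_posterior hπ1 Z m)
  have hconv : ∀ Z : Fin n → X, risk μ φ f (aggregateVector μ φ π β Z) ≤ 1 / ((n : ℝ) + 1)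
      * ∑ m ∈ Finset.range (n + 1), risk μ φ f (meanVector (posterior μ φ π β Z m)) := fun Z => by
    rw [aggregateVector_eq_average hφ.memLp hπ1]
    exact risk_average_le hφ.memLp hP.memLp n _
  have hsumi : Integrable (fun Z : Fin n → X => 1 / ((n : ℝ) + 1)
      * ∑ m ∈ Finset.range (n + 1), risk μ φ f (meanVector (posterior μ φ π β Z m)))
      (Measure.pi fun _ => P) := (integrable_finsetSum _ fun m _ => hri m).const_mul _
  have hint : Integrable (fun Z : Fin n → X => risk μ φ f (aggregateVector μ φ π β Z))
      (Measure.pi fun _ => P) := by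
    refine hsumi.mono' ((continuous_risk hφ.memLp hP.memLp).measurable.comp
      (measurable_aggregateVector hφ.measurable hφ.memLp π)).aestronglyMeasurable
      (.of_forall fun Z => ?_)
    rw [Real.norm_of_nonneg (risk_nonneg _)]
    exact hconv Z
  refine ⟨hint, ?_⟩
  have h1 := integral_mono hint hsumi hconv
  rw [integral_const_mul, integral_finsetSum _ fun m _ => hri m] at h1
  have h2 := hφ.sum_integral_risk_posterior_le hP hL hR hβ0 hβ hπ1 n
  have hci : Integrable (fun x => contrast μ x (combination φ v)) P :=
    (integrable_const _).sub (((hP.memLp_two (memLp_combination hφ.memLp v)).integrable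
      one_le_two).const_mul 2)
  have hci' : ∀ i : Fin (n + 1), Integrable (fun ω : Fin (n + 1) → X =>
      contrast μ (ω i) (combination φ v) + 4 * τ ^ 2 * M) (Measure.pi fun _ => P) := fun i =>
    ((measurePreserving_eval (fun _ : Fin (n + 1) => P) i).integrable_comp_of_integrable hci).add
      (integrable_const _)
  -- The bound holds for each sample; each of the `n + 1` contrasts then has the same expectation.
  have h3 : -β * (∫ ω : Fin (n + 1) → X, Real.log (∫ w, expWeight μ φ β ω (n + 1) w ∂π)
      ∂(Measure.pi fun _ => P))
      ≤ β * (4 * (∑ j, Real.log (1 + τ⁻¹ * |v j|)) + 1)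
        + (n + 1) * ((∫ x, contrast μ x (combination φ v) ∂P) + 4 * τ ^ 2 * M) := by
    rw [← integral_const_mul]
    refine (integral_mono ((hφ.integrable_log_integral_expWeight hL.le hR.le hβ0 hπ1
      (n + 1)).const_mul (-β)) ((integrable_const _).add (integrable_finsetSum _ fun i _ => hci' i))
      fun ω => hφ.neg_log_integral_expWeight_le hL hβ0 hτ hM hv ω).trans (le_of_eq ?_)
    simp only [Pi.add_apply]
    rw [integral_add (integrable_const _) (integrable_finsetSum _ fun i _ => hci' i),
      integral_finsetSum _ fun i _ => hci' i]
    have h4 : ∀ i : Fin (n + 1), ∫ ω : Fin (n + 1) → X,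
        (contrast μ (ω i) (combination φ v) + 4 * τ ^ 2 * M) ∂(Measure.pi fun _ => P)
          = (∫ x, contrast μ x (combination φ v) ∂P) + 4 * τ ^ 2 * M := fun i => by
      rw [integral_comp_eval (μ := fun _ : Fin (n + 1) => P)
        (f := fun x => contrast μ x (combination φ v) + 4 * τ ^ 2 * M)
        (hci.add (integrable_const _)).aestronglyMeasurable, integral_add hci (integrable_const _)]
      simp
    simp only [h4, integral_const, probReal_univ, one_smul, Finset.sum_const, Finset.card_univ,
      Fintype.card_fin, nsmul_eq_mul]
    push_cast
    ring
  rw [risk_eq_integral_contrast hφ.memLp hP v]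
  refine h1.trans ?_
  rw [one_div_mul_eq_div, div_le_iff₀ hn]
  refine (h2.trans (add_le_add_left h3 _)).trans (le_of_eq ?_)
  field_simp
  ring

end IsDictionary

end MirrorAveraging

/-! ### From almost everywhere bounds to everywhere bounds -/

namespace MirrorAveraging

variable {X : Type*} [MeasurableSpace X] {μ : Measure X}
variable {M n : ℕ} {φ ψ : Fin M → X → ℝ} {f : X → ℝ} {L β : ℝ}

lemma ae_abs_le_of_eLpNorm_top_le {g : X → ℝ} (hL : 0 ≤ L)
    (hg : eLpNorm g ∞ μ ≤ ENNReal.ofReal L) : ∀ᵐ x ∂μ, |g x| ≤ L := by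
  rw [eLpNorm_exponent_top] at hg
  filter_upwards [ae_le_eLpNormEssSup (f := g) (μ := μ)] with x hx
  have h := hx.trans hg
  rwa [← ofReal_norm, ENNReal.ofReal_le_ofReal_iff hL, Real.norm_eq_abs] at h

lemma integral_sq_eq_one_of_eLpNorm_two_eq_one {g : X → ℝ} (hgm : Measurable g)
    (hg : eLpNorm g 2 μ = 1) : MemLp g 2 μ ∧ ∫ x, g x ^ 2 ∂μ = 1 := by
  have hmem : MemLp g 2 μ := ⟨hgm.aestronglyMeasurable, by rw [hg]; exact ENNReal.one_lt_top⟩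
  refine ⟨hmem, ?_⟩
  have h := hmem.eLpNorm_eq_integral_rpow_norm two_ne_zero ENNReal.ofNat_ne_top
  rw [hg, eq_comm, ENNReal.ofReal_eq_one] at h
  simp only [ENNReal.toReal_ofNat, Real.rpow_ofNat, Real.norm_eq_abs, sq_abs] at h
  have h0 : 0 ≤ ∫ x, g x ^ 2 ∂μ := integral_nonneg fun x => sq_nonneg _
  rwa [Real.rpow_inv_eq h0 zero_le_one two_ne_zero, Real.one_rpow] at h

lemma combination_congr_ae (h : ∀ᵐ x ∂μ, ∀ j, φ j x = ψ j x) :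
    ∀ᵐ x ∂μ, ∀ w, combination φ w x = combination ψ w x := by
  filter_upwards [h] with x hx w
  simp only [combination, hx]

lemma sqLoss_congr_ae {g h : X → ℝ} (hgh : ∀ᵐ x ∂μ, g x = h x) : sqLoss μ g f = sqLoss μ h f :=
  lintegral_congr_ae (hgh.mono fun x hx => by simp only [hx])

/-- The aggregate evaluates the dictionary at the data points, so equality off a `μ`-null set is not
enough: equality at each `Z i` is also needed. -/
lemma sqLoss_maAggregate_congr (h : ∀ᵐ x ∂μ, ∀ j, φ j x = ψ j x) {Z : Fin n → X}
    (hZ : ∀ i j, φ j (Z i) = ψ j (Z i)) (π : Measure (Fin M → ℝ)) :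
    sqLoss μ (maAggregate μ φ π β Z) f = sqLoss μ (maAggregate μ ψ π β Z) f := by
  have hcomb := combination_congr_ae h
  have hcontrast : ∀ i w, contrast μ (Z i) (combination φ w) = contrast μ (Z i) (combination ψ w) :=
    fun i w => by
    have h1 : ∫ y, combination φ w y ^ 2 ∂μ = ∫ y, combination ψ w y ^ 2 ∂μ :=
      integral_congr_ae (hcomb.mono fun x hx => by simp only [hx])
    have h2 : combination φ w (Z i) = combination ψ w (Z i) := by simp only [combination, hZ]
    rw [contrast, contrast, h1, h2]
  have hdens : ∀ w, averagedDensity μ φ π β Z w = averagedDensity μ ψ π β Z w := fun w => by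
    simp only [averagedDensity, posteriorDensity, expWeight, hcontrast]
  refine sqLoss_congr_ae (hcomb.mono fun x hx => ?_)
  simp only [maAggregate, hdens, hx]

end MirrorAveraging

open MirrorAveraging in
theorem proposition3 {X : Type*} [MeasurableSpace X] (μ : Measure X)
    (M : ℕ) (hM : 2 ≤ M) (n : ℕ) (L R τ β : ℝ) (hL : 0 < L) (hR : 0 < R) (hτ : 0 < τ)
    -- the dictionary: measurable, normalized in `L²(μ)` and bounded by `L`
    (φ : Fin M → X → ℝ) (hφ : ∀ j, Measurable (φ j))
    (hφ_norm : ∀ j, eLpNorm (φ j) 2 μ = 1)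
    (hφ_bound : ∀ j, eLpNorm (φ j) ∞ μ ≤ ENNReal.ofReal L)
    -- the unknown probability density with respect to `μ`, bounded by `L`
    (f : X → ℝ) (hf : Measurable f) (hf_nonneg : 0 ≤ᵐ[μ] f)
    (hf_prob : IsProbabilityMeasure (μ.withDensity fun x => ENNReal.ofReal (f x)))
    (hf_bound : eLpNorm f ∞ μ ≤ ENNReal.ofReal L)
    -- the condition on the temperature
    (hβ : 2 * L + 4 * R * L ≤
      (β - 2 * R ^ 2) * Real.exp (-(4 * R * (L + Real.sqrt L)) / β)) :
    -- the aggregate is an estimator: its loss is a measurable function of the sample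
    Measurable (fun Z : Fin n → X =>
      MirrorAveraging.sqLoss μ
        (MirrorAveraging.maAggregate μ φ (MirrorAveraging.sparsityPrior M τ R) β Z) f) ∧
    -- the sparsity oracle inequality for its risk
    ∫⁻ Z : Fin n → X,
        MirrorAveraging.sqLoss μ
          (MirrorAveraging.maAggregate μ φ (MirrorAveraging.sparsityPrior M τ R) β Z) f
        ∂(Measure.pi fun _ : Fin n => μ.withDensity fun x => ENNReal.ofReal (f x)) ≤
      (⨅ (w : Fin M → ℝ) (_ : MirrorAveraging.l1Norm w ≤ R - 2 * M * τ),
        (MirrorAveraging.sqLoss μ (MirrorAveraging.combination φ w) f +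
          ENNReal.ofReal (4 * β / (n + 1) * ∑ j, Real.log (1 + τ⁻¹ * |w j|)))) +
      ENNReal.ofReal (4 * τ ^ 2 * M + β / (n + 1)) := by
  have hM0 : 0 < M := by omega
  -- The condition makes its right side positive, which forces `β > 2R²`.
  have hβ0 : 0 < β := by
    have h1 : 0 < (β - 2 * R ^ 2) * Real.exp (-(4 * R * (L + Real.sqrt L)) / β) :=
      lt_of_lt_of_le (by positivity) hβ
    have h2 := pos_of_mul_pos_left h1 (Real.exp_pos _).le
    linarith [sq_nonneg R]
  set P := μ.withDensity fun x => ENNReal.ofReal (f x) with hPdef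
  have hP : HasBoundedDensity μ P f L :=
    ⟨hf, hf_nonneg, (ae_abs_le_of_eLpNorm_top_le hL.le hf_bound).mono fun x hx => le_of_abs_le hx,
      rfl, hf_prob⟩
  have hφ2 := fun j => integral_sq_eq_one_of_eLpNorm_two_eq_one (hφ j) (hφ_norm j)
  have := isProbabilityMeasure_sparsityPrior (M := M) hτ hR
  have hπ := ae_l1Norm_le_sparsityPrior M τ R
  refine ⟨measurable_sqLoss_maAggregate hφ (fun j => (hφ2 j).1) hP.memLp hπ, ?_⟩
  -- Truncation at `±L` makes the bound on the dictionary hold at every point; it changes nothing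
  -- `μ`-almost everywhere.
  set ψ : Fin M → X → ℝ := fun j x => max (-L) (min L (φ j x)) with hψ
  have hφψ : ∀ᵐ x ∂μ, ∀ j, φ j x = ψ j x := ae_all_iff.2 fun j => by
    filter_upwards [ae_abs_le_of_eLpNorm_top_le hL.le (hφ_bound j)] with x hx
    simp only [hψ]
    rw [min_eq_right (le_of_abs_le hx), max_eq_right (neg_le_of_abs_le hx)]
  have hψdict : IsDictionary μ ψ L := by
    have hψφ : ∀ j, φ j =ᵐ[μ] ψ j := fun j => hφψ.mono fun x hx => hx j
    refine ⟨fun j => measurable_const.max (measurable_const.min (hφ j)),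
      fun j => (memLp_congr_ae (hψφ j)).1 (hφ2 j).1, fun j => ?_, fun j x => ?_⟩
    · rw [← (hφ2 j).2]
      exact integral_congr_ae ((hψφ j).mono fun x hx => by simp only [hx])
    · exact abs_le.2 ⟨le_max_left _ _, max_le (by linarith) (min_le_left _ _)⟩
  have hloss : ∫⁻ Z : Fin n → X, sqLoss μ (maAggregate μ φ (sparsityPrior M τ R) β Z) f
      ∂(Measure.pi fun _ : Fin n => P)
      = ∫⁻ Z : Fin n → X, ENNReal.ofReal (risk μ ψ f
        (aggregateVector μ ψ (sparsityPrior M τ R) β Z)) ∂(Measure.pi fun _ : Fin n => P) := by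
    -- The law of each observation is absolutely continuous with respect to `μ`, so almost surely
    -- the sample avoids the exceptional null set.
    have hZ : ∀ᵐ Z ∂(Measure.pi fun _ : Fin n => P), ∀ i j, φ j (Z i) = ψ j (Z i) :=
      ae_all_iff.2 fun i => (measurePreserving_eval (fun _ : Fin n => P) i).quasiMeasurePreserving.ae
        (hP.absolutelyContinuous.ae_le hφψ)
    refine lintegral_congr_ae (hZ.mono fun Z hZ => ?_)
    dsimp only
    rw [sqLoss_maAggregate_congr hφψ hZ, ← sqLoss_combination hψdict.memLp hP.memLp,
      funext (maAggregate_eq_combination hψdict.memLp hπ Z)]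
  -- The additive constant is moved across so that the infimum can be tested at each `w`; over an
  -- empty set of indices it is `∞`.
  rw [hloss, ← tsub_le_iff_right]
  refine le_iInf₂ fun w hw => ?_
  rw [tsub_le_iff_right]
  obtain ⟨hint, hle⟩ := hψdict.integral_risk_aggregateVector_le hP hL hβ0 hβ hτ hM0 hw n
  rw [← ofReal_integral_eq_lintegral_ofReal hint (.of_forall fun Z => risk_nonneg _),
    sqLoss_congr_ae ((combination_congr_ae hφψ).mono fun x hx => hx w),
    sqLoss_combination hψdict.memLp hP.memLp]
  refine (ENNReal.ofReal_le_ofReal hle).trans (ENNReal.ofReal_add_le.trans ?_)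
  gcongr
  exact ENNReal.ofReal_add_le
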